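/- Corollary 1.7. Let $\nu$ be a non-zero finite Borel measure on $(0,1)$. For $n\ge 1$ and $q\in\mathbb R$ put $\beta_n(q)=\frac{1}{\log 2^n}\log\sum_C \nu(C)^q$, the sum being over those dyadic intervals $C=(k2^{-n},(k+1)2^{-n}]$, $0\le k<2^n$, with $\nu(C)>0$, and let $\beta_\nu(q)=\limsup_{n}\beta_n(q)\in(-\infty,+\infty]$ be the $L^q$-spectrum of $\nu$. For all large $n$ the function $\beta_n$ has a unique fixed point $q_n$; put $\overline q_\nu=\limsup_n q_n$. Put $\delta^*_\nu=\beta_\nu(0)$ (this is the upper Minkowski dimension of $\operatorname{supp}\nu$) and $$\overline\delta_\nu=\lim_{t\nearrow 1}\frac{\beta_\nu(t)}{1-t},\qquad \underline\delta_\nu=\lim_{t\searrow 1}\frac{\beta_\nu(t)}{1-t}.$$ Let $\mathcal E_\nu(f,g)=\int_0^1 f'g'\,d\Lambda$ be the Dirichlet form with domain consisting of all $f\in H^1_0(0,1)$ that are affine on each connected component of $[0,1]\setminus\operatorname{supp}\nu$. A number $\lambda$ is an eigenvalue, with eigenfunction $f\ne0$ in this domain, if $\mathcal E_\nu(f,g)=\lambda\int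 fg\,d\nu$ for all $g$ in the domain. Let $N_\nu(x)$ be the number of eigenvalues not exceeding $x$, counted with multiplicity. The spectral dimension of $\nu$ is $s_\nu=\lim_{x\to\infty}\frac{\log N_\nu(x)}{\log x}$, if this limit exists. Call $\nu$ $L^q$-regular if either there is $\varepsilon>0$ with $\beta_\nu(q)=\liminf_n\beta_n(q)$ for all $q\in(\overline q_\nu-\varepsilon,\overline q_\nu)$, or $\beta_\nu(\overline q_\nu)=\liminf_n\beta_n(\overline q_\nu)$ and $\beta_\nu$ is differentiable at $\overline q_\nu$. Let $\overline{\dim}_M(\nu)$ be the upper Minkowski dimension of $\operatorname{supp}\nu$ and let $$\dim_H(\nu)=\inf\{\dim_H A:\nu(A^c)=0\},\quad \underline{\dim}_H(\nu)=\inf\{\dim_H E:\nu(E)>0\},\quad \dim_P(\nu)=\inf\{\dim_P A:\nu(A^c)=0\}$$ (infima over Borel sets), with $\dim_H$ the Hausdorff and $\dim_P$ the packing dimension of a set. Suppose that $\nu$ is $L^q$-regular. Then the spectral dimension $s_\nu$ exists, and: 1. $\overline\delta_\nu=\delta^*_\nu$ if and only if $s_\nu=\dfrac{\delta^*_\nu}{1+\delta^*_\nu}$;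 in particular, $\underline\delta_\nu=\delta^*_\nu$ implies $s_\nu=\dfrac{\delta^*_\nu}{1+\delta^*_\nu}$. 2. If $\overline{\dim}_M(\nu)=\dim_H(\nu)$, then $s_\nu=\dfrac{\delta^*_\nu}{1+\delta^*_\nu}$. 3. If $\beta_\nu$ is differentiable at $1$ and $s_\nu=\dfrac{\delta^*_\nu}{1+\delta^*_\nu}$, then $\overline{\dim}_M(\nu)=\dim_H(\nu)=\underline{\dim}_H(\nu)=\dim_P(\nu)$. -/

import Mathlib

open MeasureTheory Set Filter Topology
open scoped ENNReal NNReal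

noncomputable section

namespace KreinFeller

/-! ## Dirichlet form and spectral dimension on the unit interval -/

/-- `g` is the square integrable weak derivative of `f` on `[0,1]`; the existence of such a `g`
says that `f` belongs to `H¹(0,1)`. -/
def HasWeakDeriv (f g : ℝ → ℝ) : Prop :=
  MemLp g 2 (volume.restrict (Icc (0 : ℝ) 1)) ∧
    ∀ x ∈ Icc (0 : ℝ) 1, f x = f 0 + ∫ t in (0 : ℝ)..x, g t

open Classical in
/-- A representative of the (almost everywhere unique) weak derivative of `f`. -/
def weakDeriv (f : ℝ → ℝ) : ℝ → ℝ :=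
  if h : ∃ g, HasWeakDeriv f g then h.choose else 0

/-- The domain `H¹₀(0,1) ∩ C_ν([0,1])` of the form.  Functions on `[0,1]` are represented by
their extension by zero to `ℝ`.  The last clause says that `f` is affine on the connected
components of `[0,1] \ supp ν`: these are the maximal intervals contained in that set. -/
def formDomain (ν : Measure ℝ) : Set (ℝ → ℝ) :=
  {f | (∃ g, HasWeakDeriv f g) ∧ f 0 = 0 ∧ f 1 = 0 ∧ (∀ x ∉ Icc (0 : ℝ) 1, f x = 0) ∧
    ∀ J : Set ℝ, J.OrdConnected → J ⊆ Icc 0 1 \ ν.support →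
      ∃ p q : ℝ, ∀ z ∈ J, f z = p * z + q}

/-- The form `𝓔(f,h) = ∫₀¹ f' h' dΛ`. -/
def energy (f h : ℝ → ℝ) : ℝ :=
  ∫ t in (0 : ℝ)..1, weakDeriv f t * weakDeriv h t

/-- `f` is an eigenfunction of the Dirichlet form of `ν` with eigenvalue `lam`. -/
def IsEigenfunction (ν : Measure ℝ) (lam : ℝ) (f : ℝ → ℝ) : Prop :=
  f ∈ formDomain ν ∧ f ≠ 0 ∧
    ∀ h ∈ formDomain ν, energy f h = lam * ∫ t, f t * h t ∂ν

/-- The eigenvalue counting function: the number of eigenvalues not exceeding `x`, counted with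
multiplicity, that is, the dimension of the span of all eigenfunctions whose eigenvalue is at
most `x` (eigenfunctions with distinct eigenvalues are orthogonal in `L²(ν)`, so the eigenspaces
form a direct sum). -/
def eigenvalueCount (ν : Measure ℝ) (x : ℝ) : ℕ :=
  Module.finrank ℝ (Submodule.span ℝ {f : ℝ → ℝ | ∃ lam ≤ x, IsEigenfunction ν lam f})

/-- The spectral dimension of `ν` exists and equals `s`, i.e. the lower and upper exponents of
divergence of the eigenvalue counting function are both equal to `s`. -/
def HasSpectralDim (ν : Measure ℝ) (s : ℝ) : Prop :=
  Tendsto (fun x : ℝ => Real.log (eigenvalueCount ν x) / Real.log x) atTop (𝓝 s)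

/-! ## The `L^q`-spectrum -/

/-- The dyadic interval `(k 2⁻ⁿ, (k+1) 2⁻ⁿ]`. -/
def dyadic (n k : ℕ) : Set ℝ := Ioc ((k : ℝ) / 2 ^ n) (((k : ℝ) + 1) / 2 ^ n)

open Classical in
/-- `β_n(q) = (log 2ⁿ)⁻¹ log ∑ ν(C)^q`, summed over the dyadic intervals `C` of order `n` in
`(0,1]` of positive measure. -/
def betaN (ν : Measure ℝ) (n : ℕ) (q : ℝ) : ℝ :=
  Real.log (∑ k ∈ (Finset.range (2 ^ n)).filter (fun k => 0 < ν (dyadic n k)),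
    (ν.real (dyadic n k)) ^ q) / Real.log (2 ^ n)

/-- The `L^q`-spectrum `β(q) = limsup β_n(q)`.  It is finite for `q ≥ 0`, and may be `+∞` for
negative `q`. -/
def beta (ν : Measure ℝ) (q : ℝ) : EReal :=
  limsup (fun n : ℕ => (betaN ν n q : EReal)) atTop

/-- `liminf β_n(q)`. -/
def betaLower (ν : Measure ℝ) (q : ℝ) : EReal :=
  liminf (fun n : ℕ => (betaN ν n q : EReal)) atTop

/-- The fixed point of `β_n`.  For all large `n` the function `β_n` has exactly one fixed point,
so that the set below is a singleton. -/
def fixedPoint (ν : Measure ℝ) (n : ℕ) : ℝ := sInf {q : ℝ | betaN ν n q = q}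

/-- `q̄ = limsup q_n`, with `q_n` the fixed point of `β_n` (`q_n ∈ [0,1)` for all large `n`). -/
def qBar (ν : Measure ℝ) : ℝ := limsup (fun n : ℕ => fixedPoint ν n) atTop

/-- `β` is differentiable at `q`: it is finite near `q` and differentiable there. -/
def BetaDifferentiableAt (ν : Measure ℝ) (q : ℝ) : Prop :=
  (∀ᶠ t in 𝓝 q, beta ν t ≠ ⊤ ∧ beta ν t ≠ ⊥) ∧
    DifferentiableAt ℝ (fun t => (beta ν t).toReal) q

/-- `ν` is `L^q`-regular. -/
def IsLqRegular (ν : Measure ℝ) : Prop :=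
  (∃ ε > 0, ∀ q ∈ Ioo (qBar ν - ε) (qBar ν), beta ν q = betaLower ν q) ∨
    (beta ν (qBar ν) = betaLower ν (qBar ν) ∧ BetaDifferentiableAt ν (qBar ν))

/-- `δ* = β(0)`, a number in `[0,1]`. -/
def deltaStar (ν : Measure ℝ) : ℝ := (beta ν 0).toReal

/-- `δ̄ = d`, where `δ̄ = lim_{t ↗ 1} β(t) / (1 - t)`. -/
def DeltaUpperEq (ν : Measure ℝ) (d : ℝ) : Prop :=
  Tendsto (fun t : ℝ => (beta ν t).toReal / (1 - t)) (𝓝[<] 1) (𝓝 d)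

/-- `δ̲ = d`, where `δ̲ = lim_{t ↘ 1} β(t) / (1 - t)`. -/
def DeltaLowerEq (ν : Measure ℝ) (d : ℝ) : Prop :=
  Tendsto (fun t : ℝ => (beta ν t).toReal / (1 - t)) (𝓝[>] 1) (𝓝 d)

/-! ## Dimensions of sets and measures -/

/-- The upper Minkowski (box-counting) dimension `limsup_{ε → 0} log N_ε(A) / log (1/ε)`, with
`N_ε(A)` the least number of closed balls of radius `ε` that cover `A`. -/
def upperMinkowskiDim (A : Set ℝ) : ℝ≥0∞ :=
  (limsup (fun ε : ℝ≥0 => ENNReal.log ((Metric.externalCoveringNumber ε A : ℕ∞) : ℝ≥0∞) /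
    ((-Real.log (ε : ℝ) : ℝ) : EReal)) (𝓝[>] 0)).toENNReal

/-- The packing dimension: the infimum, over countable covers `(F i)` of `A`, of the supremum of
the upper Minkowski dimensions of the pieces (unbounded pieces have dimension `∞`). -/
def packingDim (A : Set ℝ) : ℝ≥0∞ :=
  ⨅ (F : ℕ → Set ℝ) (_ : A ⊆ ⋃ i, F i), ⨆ i, upperMinkowskiDim (F i)

/-- The upper Minkowski dimension of `ν` is that of its support. -/
def measureMinkowskiDim (ν : Measure ℝ) : ℝ≥0∞ := upperMinkowskiDim ν.support

/-- The Hausdorff dimension of `ν`, `inf {dim_H A : ν(Aᶜ) = 0}` over Borel sets. -/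
def measureHausdorffDim (ν : Measure ℝ) : ℝ≥0∞ :=
  ⨅ (A : Set ℝ) (_ : MeasurableSet A) (_ : ν Aᶜ = 0), dimH A

/-- The lower Hausdorff dimension of `ν`, `inf {dim_H E : ν(E) > 0}` over Borel sets. -/
def measureLowerHausdorffDim (ν : Measure ℝ) : ℝ≥0∞ :=
  ⨅ (E : Set ℝ) (_ : MeasurableSet E) (_ : 0 < ν E), dimH E

/-- The packing dimension of `ν`, `inf {dim_P A : ν(Aᶜ) = 0}` over Borel sets. -/
def measurePackingDim (ν : Measure ℝ) : ℝ≥0∞ :=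
  ⨅ (A : Set ℝ) (_ : MeasurableSet A) (_ : ν Aᶜ = 0), packingDim A

end KreinFeller

end

/-!
The eigenvalues of the form are the reciprocals of the nonzero eigenvalues of the compact operator
`ι* ι`, where `ι` maps a derivative to its primitive in `L²(ν)`, so the eigenvalue counting
function can be estimated by min-max. Bisecting the unit interval until every cell `C` satisfies
`ν(C) Λ(C) < t`, and requiring a primitive to vanish at the midpoints of the bisected cells, bounds
it from above; trapezoidal functions over well separated heavy cells bound it from below. Both
bounds count heavy dyadic cells, and for an `L^q`-regular measure both have the growth exponent
`q̄`, the fixed point of the convex function `β`.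

By convexity, `β` lies below its chord from `(0, δ*)` to `(1, 0)`, whose fixed point is
`δ* / (1 + δ*)`. So `q̄ = δ* / (1 + δ*)` exactly when `β` is affine on `[0,1]`, which is exactly
when its left slope at `1` is that of the chord. By Borel–Cantelli, the one-sided slopes of `β` at
`1` bound the Hausdorff dimensions of `ν`: the left one from above and the right one from below.
-/

noncomputable section

namespace KreinFeller

/-! ### Rayleigh quotients of compact symmetric operators -/

section Spectral

open Module Module.End

variable {𝕜 H : Type*} [RCLike 𝕜] [NormedAddCommGroup H] [InnerProductSpace 𝕜 H]
  {A : H →L[𝕜] H} {c : ℝ} {x : H}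

/-- The span of the eigenvectors of `A` whose eigenvalue lies in `s`. For compact symmetric `A`
its closure is the range of the spectral projection of `s`. -/
def spectralSubspace (A : H →L[𝕜] H) (s : Set ℝ) : Submodule 𝕜 H :=
  ⨆ μ : s, eigenspace (A : End 𝕜 H) ((μ : ℝ) : 𝕜)

lemma eigenspace_le_spectralSubspace {s : Set ℝ} {μ : ℝ} (hμ : μ ∈ s) :
    eigenspace (A : End 𝕜 H) (μ : 𝕜) ≤ spectralSubspace A s :=
  le_iSup (fun μ : s => eigenspace (A : End 𝕜 H) ((μ : ℝ) : 𝕜)) ⟨μ, hμ⟩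

lemma exists_reApplyInnerSelf_eq_sum (hA : (A : H →ₗ[𝕜] H).IsSymmetric) {s : Set ℝ}
    (hx : x ∈ spectralSubspace A s) :
    ∃ (t : Finset s) (f : s → H), A.reApplyInnerSelf x = ∑ μ ∈ t, (μ : ℝ) * ‖f μ‖ ^ 2 ∧
      ‖x‖ ^ 2 = ∑ μ ∈ t, ‖f μ‖ ^ 2 := by
  obtain ⟨f, hf, rfl⟩ := (Submodule.mem_iSup_iff_exists_finsupp _ _).1 hx
  have hV := hA.orthogonalFamily_eigenspaces.comp
    (RCLike.ofReal_injective.comp Subtype.val_injective : Function.Injective fun μ : s => _)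
  let g (μ : s) : eigenspace (A : End 𝕜 H) ((μ : ℝ) : 𝕜) := ⟨f μ, hf μ⟩
  have hAf (μ : s) : A (f μ) = ((μ : ℝ) : 𝕜) • f μ := mem_eigenspace_iff.1 (hf μ)
  refine ⟨f.support, f, ?_, hV.norm_sum g f.support⟩
  have hinner := hV.inner_sum (fun μ => ((μ : ℝ) : 𝕜) • g μ) g f.support
  rw [ContinuousLinearMap.reApplyInnerSelf_apply, Finsupp.sum, map_sum,
    Finset.sum_congr rfl fun μ _ => hAf μ]
  refine (congrArg RCLike.re hinner).trans ?_
  rw [map_sum]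
  refine Finset.sum_congr rfl fun μ _ => ?_
  rw [inner_smul_left, RCLike.conj_ofReal, RCLike.re_ofReal_mul, inner_self_eq_norm_sq,
    Submodule.coe_norm]

lemma mul_norm_sq_le_reApplyInnerSelf (hA : (A : H →ₗ[𝕜] H).IsSymmetric)
    (hx : x ∈ spectralSubspace A (Ici c)) : c * ‖x‖ ^ 2 ≤ A.reApplyInnerSelf x := by
  obtain ⟨t, f, hinner, hnorm⟩ := exists_reApplyInnerSelf_eq_sum hA hx
  rw [hinner, hnorm, Finset.mul_sum]
  exact Finset.sum_le_sum fun μ _ => mul_le_mul_of_nonneg_right μ.2 (sq_nonneg _)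

lemma reApplyInnerSelf_le_mul_norm_sq (hA : (A : H →ₗ[𝕜] H).IsSymmetric)
    (hx : x ∈ spectralSubspace A (Iio c)) : A.reApplyInnerSelf x ≤ c * ‖x‖ ^ 2 := by
  obtain ⟨t, f, hinner, hnorm⟩ := exists_reApplyInnerSelf_eq_sum hA hx
  rw [hinner, hnorm, Finset.mul_sum]
  exact Finset.sum_le_sum fun μ _ => mul_le_mul_of_nonneg_right (le_of_lt μ.2) (sq_nonneg _)

lemma spectralSubspace_isOrtho (hA : (A : H →ₗ[𝕜] H).IsSymmetric) {s t : Set ℝ}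
    (hst : Disjoint s t) : spectralSubspace A s ⟂ spectralSubspace A t :=
  Submodule.isOrtho_iSup_left.2 fun i => Submodule.isOrtho_iSup_right.2 fun j =>
    hA.orthogonalFamily_eigenspaces.isOrtho <| RCLike.ofReal_injective.ne (hst.ne_of_mem i.2 j.2)

lemma orthogonal_spectralSubspace [CompleteSpace H] (hA : (A : H →ₗ[𝕜] H).IsSymmetric)
    (hc : IsCompactOperator A) (s : Set ℝ) :
    (spectralSubspace A s)ᗮ = (spectralSubspace A sᶜ).topologicalClosure := by
  set R := spectralSubspace A sᶜ
  set S := spectralSubspace A s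
  have hRS : R.topologicalClosure ≤ Sᗮ := Submodule.topologicalClosure_minimal _
    (spectralSubspace_isOrtho hA disjoint_compl_left) (Submodule.isClosed_orthogonal _)
  have htop : (R ⊔ S)ᗮ = ⊥ := by
    rw [eq_bot_iff, ← ContinuousLinearMap.orthogonalComplement_iSup_eigenspaces_eq_bot hc hA]
    refine Submodule.orthogonal_le (iSup_le fun μ => ?_)
    rcases eq_or_ne (eigenspace (A : End 𝕜 H) μ) ⊥ with hμ | hμ
    · exact hμ.le.trans bot_le
    · obtain ⟨r, rfl⟩ := RCLike.conj_eq_iff_real.1 (hA.conj_eigenvalue_eq_self hμ)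
      by_cases hr : r ∈ s
      · exact (eigenspace_le_spectralSubspace hr).trans le_sup_right
      · exact (eigenspace_le_spectralSubspace (s := sᶜ) hr).trans le_sup_left
  have : CompleteSpace R.topologicalClosure := R.isClosed_topologicalClosure.completeSpace_coe
  rw [← Submodule.sup_orthogonal_inf_of_hasOrthogonalProjection hRS,
    Submodule.orthogonal_closure, Submodule.inf_orthogonal, htop, sup_bot_eq]

lemma reApplyInnerSelf_le_of_mem_orthogonal [CompleteSpace H]
    (hA : (A : H →ₗ[𝕜] H).IsSymmetric) (hc : IsCompactOperator A)
    (hx : x ∈ (spectralSubspace A (Ici c))ᗮ) : A.reApplyInnerSelf x ≤ c * ‖x‖ ^ 2 := by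
  rw [orthogonal_spectralSubspace hA hc, compl_Ici] at hx
  have hclosed : IsClosed {y : H | A.reApplyInnerSelf y ≤ c * ‖y‖ ^ 2} :=
    isClosed_le A.reApplyInnerSelf_continuous (by fun_prop)
  exact closure_minimal (fun y hy => reApplyInnerSelf_le_mul_norm_sq hA hy) hclosed hx

lemma finrank_le_finrank_spectralSubspace [CompleteSpace H] {F : Type*} [AddCommGroup F]
    [Module 𝕜 F] (hA : (A : H →ₗ[𝕜] H).IsSymmetric) (hc : IsCompactOperator A)
    [FiniteDimensional 𝕜 (spectralSubspace A (Ici c))] (L : F →ₗ[𝕜] H)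
    (hL : ∀ v ≠ 0, c * ‖L v‖ ^ 2 < A.reApplyInnerSelf (L v)) :
    finrank 𝕜 F ≤ finrank 𝕜 (spectralSubspace A (Ici c)) := by
  set S := spectralSubspace A (Ici c)
  refine LinearMap.finrank_le_finrank_of_injective
    (f := S.orthogonalProjectionOnto.toLinearMap.comp L) ?_
  rw [injective_iff_map_eq_zero]
  intro v hv
  by_contra hv0
  exact (hL v hv0).not_ge <| reApplyInnerSelf_le_of_mem_orthogonal hA hc <|
    Submodule.orthogonalProjectionOnto_eq_zero_iff.1 hv

lemma injective_domRestrict_spectralSubspace {F : Type*} [AddCommGroup F] [Module 𝕜 F]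
    (hA : (A : H →ₗ[𝕜] H).IsSymmetric) (L : H →ₗ[𝕜] F)
    (hL : ∀ v ≠ 0, L v = 0 → A.reApplyInnerSelf v < c * ‖v‖ ^ 2) :
    Function.Injective (L.domRestrict (spectralSubspace A (Ici c))) := by
  rw [injective_iff_map_eq_zero]
  rintro ⟨v, hv⟩ hLv
  by_contra hv0
  exact (hL v (by simpa using hv0) hLv).not_ge (mul_norm_sq_le_reApplyInnerSelf hA hv)

end Spectral

lemma isCompactOperator_of_norm_le_on_orthogonal {𝕜 H E : Type*} [RCLike 𝕜]
    [NormedAddCommGroup H] [InnerProductSpace 𝕜 H] [NormedAddCommGroup E] [NormedSpace 𝕜 E]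
    [CompleteSpace E] (T : H →L[𝕜] E)
    (hT : ∀ ε > 0, ∃ B : Set H, B.Finite ∧ ∀ u, (∀ b ∈ B, inner 𝕜 b u = 0) → ‖T u‖ ≤ ε * ‖u‖) :
    IsCompactOperator T := by
  have hmem : T ∈ closure {S : H →L[𝕜] E | IsCompactOperator S} := by
    refine Metric.mem_closure_iff.2 fun ε hε => ?_
    obtain ⟨B, hBfin, hB⟩ := hT (ε / 2) (half_pos hε)
    set F := Submodule.span 𝕜 B
    have : FiniteDimensional 𝕜 F := .span_of_finite 𝕜 hBfin
    have hfinite : IsCompactOperator F.orthogonalProjectionOnto :=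
      isCompactOperator_of_locallyCompactSpace_dom _
    refine ⟨T ∘L F.starProjection, hfinite.clm_comp (T ∘L F.subtypeL), ?_⟩
    rw [dist_eq_norm]
    refine lt_of_le_of_lt (ContinuousLinearMap.opNorm_le_bound _ (half_pos hε).le fun v => ?_)
      (half_lt_self hε)
    have horth : (T - T ∘L F.starProjection) v = T (Fᗮ.starProjection v) := by
      simp [Submodule.starProjection_orthogonal]
    refine (congrArg norm horth).trans_le ((hB _ fun b hb => ?_).trans
      (mul_le_mul_of_nonneg_left (Fᗮ.norm_starProjection_apply_le v) (half_pos hε).le))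
    exact Fᗮ.starProjection_apply_mem v b (Submodule.subset_span hb)
  rwa [isClosed_setOfPred_isCompactOperator.closure_eq] at hmem

/-! ### Primitives of square integrable functions on the unit interval -/

section Integral

variable {α : Type*} [MeasurableSpace α] {μ : Measure α} {f : α → ℝ}

lemma sq_integral_le [IsFiniteMeasure μ] (hf : MemLp f 2 μ) :
    (∫ x, f x ∂μ) ^ 2 ≤ μ.real univ * ∫ x, f x ^ 2 ∂μ := by
  have h1 : MemLp (fun _ => (1 : ℝ)) 2 μ := memLp_const 1
  have hinner {u v : α → ℝ} (hu : MemLp u 2 μ) (hv : MemLp v 2 μ) :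
      inner ℝ (hu.toLp u) (hv.toLp v) = ∫ x, u x * v x ∂μ := by
    refine (L2.inner_def _ _).trans (integral_congr_ae ?_)
    filter_upwards [hu.coeFn_toLp, hv.coeFn_toLp] with x hux hvx
    rw [hux, hvx, RCLike.inner_apply', conj_trivial]
  have hcs := real_inner_mul_inner_self_le (h1.toLp _) (hf.toLp f)
  rw [hinner, hinner, hinner] at hcs
  simpa [pow_two] using hcs

lemma ae_eq_of_intervalIntegral_eq {E : Type*} [NormedAddCommGroup E] [NormedSpace ℝ E]
    [CompleteSpace E] {a b : ℝ} (hab : a ≤ b) {u v : ℝ → E} (hu : IntegrableOn u (Icc a b))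
    (hv : IntegrableOn v (Icc a b))
    (h : ∀ x ∈ Icc a b, ∫ t in a..x, u t = ∫ t in a..x, v t) :
    u =ᵐ[volume.restrict (Icc a b)] v := by
  rw [← intervalIntegrable_iff_integrableOn_Icc_of_le hab] at hu hv
  rw [← restrict_Ioo_eq_restrict_Icc, Filter.EventuallyEq, ae_restrict_iff' measurableSet_Ioo]
  filter_upwards [hu.ae_hasDerivAt_integral, hv.ae_hasDerivAt_integral] with x hux hvx hx
  rw [uIcc_of_le hab] at hux hvx
  have hx' := Ioo_subset_Icc_self hx
  refine (hux hx' a ⟨le_rfl, hab⟩).unique ((hvx hx' a ⟨le_rfl, hab⟩).congr_of_eventuallyEq ?_)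
  filter_upwards [Icc_mem_nhds hx.1 hx.2] with y hy using h y hy

end Integral

/-- Lebesgue measure on `[0,1]`. -/
abbrev unitMeasure : Measure ℝ := volume.restrict (Icc (0 : ℝ) 1)

/-- The Hilbert space `L²[0,1]`. Its elements stand for the weak derivatives of functions
vanishing at `0`, which turns the Dirichlet form into the inner product. -/
abbrev UnitL2 : Type := Lp ℝ 2 unitMeasure

/-- The indicator function of `(0,x]` in `L²[0,1]`, which represents evaluation at `x`. -/
def initialIndicator (x : ℝ) : UnitL2 :=
  indicatorConstLp 2 (measurableSet_Ioc (a := (0 : ℝ)) (b := x)) (measure_ne_top unitMeasure _) 1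

/-- The primitive `x ↦ ∫₀ˣ g` of `g`; it is constant on `(-∞,0]` and on `[1,∞)`. -/
def primitive : UnitL2 →ₗ[ℝ] ℝ → ℝ :=
  LinearMap.pi fun x => innerₗ UnitL2 (initialIndicator x)

section Primitive

variable (g h : UnitL2) {x y : ℝ}

lemma primitive_apply (x : ℝ) : primitive g x = inner ℝ (initialIndicator x) g := rfl

lemma primitive_eq_setIntegral (x : ℝ) : primitive g x = ∫ t in Ioc 0 x, g t ∂unitMeasure :=
  L2.inner_indicatorConstLp_one measurableSet_Ioc _ g

lemma restrict_unitMeasure_Ioc (hx : 0 ≤ x) (hy : y ≤ 1) :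
    unitMeasure.restrict (Ioc x y) = volume.restrict (Ioc x y) :=
  Measure.restrict_restrict_of_subset fun _ ht => ⟨hx.trans ht.1.le, ht.2.trans hy⟩

lemma primitive_eq_intervalIntegral (hx : x ∈ Icc (0 : ℝ) 1) :
    primitive g x = ∫ t in (0 : ℝ)..x, g t := by
  rw [primitive_eq_setIntegral, intervalIntegral.integral_of_le hx.1,
    restrict_unitMeasure_Ioc le_rfl hx.2]

lemma primitive_of_nonpos (hx : x ≤ 0) : primitive g x = 0 := by
  rw [primitive_eq_setIntegral, Ioc_eq_empty_of_le hx, setIntegral_empty]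

lemma primitive_of_one_le (hx : 1 ≤ x) : primitive g x = primitive g 1 := by
  have hinter : Ioc 0 x ∩ Icc (0 : ℝ) 1 = Ioc 0 1 ∩ Icc (0 : ℝ) 1 := by
    ext t
    simp only [mem_inter_iff, mem_Ioc, mem_Icc]
    grind
  rw [primitive_eq_setIntegral, primitive_eq_setIntegral,
    Measure.restrict_restrict measurableSet_Ioc, Measure.restrict_restrict measurableSet_Ioc,
    hinter]

lemma primitive_eq_zero_of_notMem_Icc (hg : primitive g 1 = 0) (hx : x ∉ Icc (0 : ℝ) 1) :
    primitive g x = 0 := by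
  rcases not_and_or.1 hx with hx | hx
  · exact primitive_of_nonpos g (not_le.1 hx).le
  · rw [primitive_of_one_le g (not_le.1 hx).le, hg]

lemma integrable_coe : Integrable g unitMeasure := (Lp.memLp g).integrable one_le_two

lemma integrable_coe_sq : Integrable (fun t => g t ^ 2) unitMeasure := (Lp.memLp g).integrable_sq

lemma setIntegral_sq_le_norm_sq (s : Set ℝ) : ∫ t in s, g t ^ 2 ∂unitMeasure ≤ ‖g‖ ^ 2 := by
  have hnorm : ‖g‖ ^ 2 = ∫ t, g t ^ 2 ∂unitMeasure := by
    rw [← real_inner_self_eq_norm_sq, L2.inner_def]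
    simp [pow_two]
  rw [hnorm]
  exact setIntegral_le_integral (integrable_coe_sq g) (ae_of_all _ fun t => sq_nonneg _)

lemma primitive_sub_primitive (hx : 0 ≤ x) (hxy : x ≤ y) :
    primitive g y - primitive g x = ∫ t in Ioc x y, g t ∂unitMeasure := by
  rw [primitive_eq_setIntegral, primitive_eq_setIntegral, sub_eq_iff_eq_add',
    ← setIntegral_union (Ioc_disjoint_Ioc_of_le le_rfl) measurableSet_Ioc
      (integrable_coe g).integrableOn (integrable_coe g).integrableOn,
    Ioc_union_Ioc_eq_Ioc hx hxy]

lemma sq_primitive_sub_le (hx : 0 ≤ x) (hxy : x ≤ y) :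
    (primitive g y - primitive g x) ^ 2 ≤ (y - x) * ∫ t in Ioc x y, g t ^ 2 ∂unitMeasure := by
  have hlen : (unitMeasure.restrict (Ioc x y)).real univ ≤ y - x := by
    rw [measureReal_restrict_apply_univ, ← Real.volume_real_Ioc_of_le hxy]
    exact ENNReal.toReal_mono measure_Ioc_lt_top.ne (Measure.restrict_apply_le _ _)
  rw [primitive_sub_primitive g hx hxy]
  exact (sq_integral_le ((Lp.memLp g).restrict _)).trans
    (mul_le_mul_of_nonneg_right hlen (integral_nonneg fun t => sq_nonneg _))

lemma abs_primitive_le (x : ℝ) : |primitive g x| ≤ ‖g‖ := by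
  have hle : ‖initialIndicator x‖ ≤ 1 := by
    have hmeas : unitMeasure.real (Ioc 0 x) ≤ 1 :=
      (measureReal_mono (subset_univ _)).trans_eq (by simp)
    rw [initialIndicator, norm_indicatorConstLp (by simp) (by simp), norm_one, one_mul]
    exact Real.rpow_le_one measureReal_nonneg hmeas (by simp)
  exact (abs_real_inner_le_norm _ _).trans (mul_le_of_le_one_left (norm_nonneg _) hle)

lemma continuous_primitive : Continuous (primitive g) := by
  have hprim (x : ℝ) : primitive g x = ∫ t in (0 : ℝ)..max 0 x, g t ∂unitMeasure := by
    rw [intervalIntegral.integral_of_le (le_max_left _ _), ← primitive_eq_setIntegral]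
    rcases le_total 0 x with hx | hx
    · rw [max_eq_right hx]
    · rw [max_eq_left hx, primitive_of_nonpos g hx, primitive_of_nonpos g le_rfl]
  rw [funext hprim]
  exact (intervalIntegral.continuous_primitive
    (fun a b => (integrable_coe g).intervalIntegrable) 0).comp (continuous_const.max continuous_id)

lemma primitive_injective : Function.Injective primitive := by
  intro g h hgh
  refine Lp.ext (ae_eq_of_intervalIntegral_eq zero_le_one (integrable_coe g) (integrable_coe h)
    fun x hx => ?_)
  rw [← primitive_eq_intervalIntegral g hx, ← primitive_eq_intervalIntegral h hx, hgh]

lemma hasWeakDeriv_primitive : HasWeakDeriv (primitive g) g :=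
  ⟨Lp.memLp g, fun x hx => by
    rw [primitive_of_nonpos g le_rfl, zero_add, primitive_eq_intervalIntegral g hx]⟩

lemma weakDeriv_primitive : weakDeriv (primitive g) =ᵐ[unitMeasure] g := by
  have hex : ∃ u, HasWeakDeriv (primitive g) u := ⟨g, hasWeakDeriv_primitive g⟩
  obtain ⟨hmem, hint⟩ : HasWeakDeriv (primitive g) (weakDeriv (primitive g)) := by
    rw [weakDeriv, dif_pos hex]
    exact hex.choose_spec
  refine ae_eq_of_intervalIntegral_eq zero_le_one (hmem.integrable one_le_two) (integrable_coe g)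
    fun x hx => ?_
  rw [← primitive_eq_intervalIntegral g hx, hint x hx, primitive_of_nonpos g le_rfl, zero_add]

lemma energy_primitive : energy (primitive g) (primitive h) = inner ℝ g h := by
  rw [energy, intervalIntegral.integral_of_le zero_le_one, ← integral_Icc_eq_integral_Ioc,
    L2.inner_def]
  refine integral_congr_ae ?_
  filter_upwards [weakDeriv_primitive g, weakDeriv_primitive h] with t hgt hht
  rw [hgt, hht, RCLike.inner_apply', conj_trivial]

end Primitive

lemma exists_eq_primitive {f : ℝ → ℝ} (hf : ∃ g, HasWeakDeriv f g) (h0 : f 0 = 0) (h1 : f 1 = 0)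
    (hout : ∀ x ∉ Icc (0 : ℝ) 1, f x = 0) : ∃ g : UnitL2, f = primitive g := by
  obtain ⟨u, hu, hfu⟩ := hf
  have heq (x : ℝ) (hx : x ∈ Icc (0 : ℝ) 1) : f x = primitive (hu.toLp u) x := by
    rw [hfu x hx, h0, zero_add, intervalIntegral.integral_of_le hx.1,
      ← restrict_unitMeasure_Ioc le_rfl hx.2, primitive_eq_setIntegral]
    exact integral_congr_ae (ae_restrict_of_ae hu.coeFn_toLp.symm)
  refine ⟨hu.toLp u, funext fun x => ?_⟩
  by_cases hx : x ∈ Icc (0 : ℝ) 1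
  · exact heq x hx
  · rw [hout x hx, primitive_eq_zero_of_notMem_Icc _ ?_ hx]
    rw [← heq 1 (right_mem_Icc.2 zero_le_one), h1]

section Embedding

variable (ν : Measure ℝ) [IsFiniteMeasure ν]

lemma memLp_primitive (g : UnitL2) : MemLp (primitive g) 2 ν :=
  MemLp.of_bound (continuous_primitive g).aestronglyMeasurable ‖g‖
    (ae_of_all _ fun x => abs_primitive_le g x)

/-- The map sending a derivative to its primitive, seen in `L²(ν)`. The Rayleigh quotient of the
Dirichlet form of `ν` is the reciprocal of `‖embed ν g‖² / ‖g‖²`. -/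
def embed : UnitL2 →L[ℝ] Lp ℝ 2 ν :=
  LinearMap.mkContinuous
    { toFun := fun g => (memLp_primitive ν g).toLp _
      map_add' := fun g h => by
        simp only [map_add]
        rfl
      map_smul' := fun c g => by
        simp only [map_smul]
        rfl }
    (ν.real univ ^ (2 : ℝ≥0∞).toReal⁻¹) fun g => by
      refine (Lp.norm_le_of_ae_bound (C := ‖g‖) (norm_nonneg _) ?_).trans_eq ?_
      · filter_upwards [(memLp_primitive ν g).coeFn_toLp] with x hx
        exact (congrArg norm hx).trans_le (abs_primitive_le g x)
      · simp [measureUnivNNReal, Measure.real, ENNReal.coe_toNNReal_eq_toReal]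

lemma coeFn_embed (g : UnitL2) : embed ν g =ᵐ[ν] primitive g := (memLp_primitive ν g).coeFn_toLp

lemma inner_embed (g h : UnitL2) :
    inner ℝ (embed ν g) (embed ν h) = ∫ x, primitive g x * primitive h x ∂ν := by
  refine (L2.inner_def _ _).trans (integral_congr_ae ?_)
  filter_upwards [coeFn_embed ν g, coeFn_embed ν h] with x hg hh
  rw [hg, hh, RCLike.inner_apply', conj_trivial]

lemma norm_embed_sq (g : UnitL2) : ‖embed ν g‖ ^ 2 = ∫ x, primitive g x ^ 2 ∂ν := by
  rw [← real_inner_self_eq_norm_sq, inner_embed]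
  simp only [pow_two]

lemma integrable_primitive_sq (g : UnitL2) : Integrable (fun x => primitive g x ^ 2) ν :=
  (memLp_primitive ν g).integrable_sq

variable {ν} in
lemma setIntegral_primitive_sq_le (g : UnitL2) {a b : ℝ} (ha : 0 ≤ a) (hga : primitive g a = 0) :
    ∫ x in Ioc a b, primitive g x ^ 2 ∂ν ≤
      ν.real (Ioc a b) * (b - a) * ∫ x in Ioc a b, g x ^ 2 ∂unitMeasure := by
  set Q := ∫ x in Ioc a b, g x ^ 2 ∂unitMeasure
  have hpointwise (x : ℝ) (hx : x ∈ Ioc a b) : primitive g x ^ 2 ≤ (b - a) * Q := by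
    have hsq := sq_primitive_sub_le g ha hx.1.le
    rw [hga, sub_zero] at hsq
    refine hsq.trans (mul_le_mul (by linarith [hx.2]) ?_ (integral_nonneg fun t => sq_nonneg _)
      (by linarith [hx.1, hx.2]))
    exact setIntegral_mono_set (integrable_coe_sq g).integrableOn
      (ae_of_all _ fun x => sq_nonneg _) (LE.le.eventuallyLE (Ioc_subset_Ioc_right hx.2))
  calc ∫ x in Ioc a b, primitive g x ^ 2 ∂ν ≤ ∫ _ in Ioc a b, (b - a) * Q ∂ν :=
        setIntegral_mono_on (integrable_primitive_sq ν g).integrableOn (integrable_const _)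
          measurableSet_Ioc hpointwise
    _ = ν.real (Ioc a b) * (b - a) * Q := by rw [setIntegral_const, smul_eq_mul, mul_assoc]

end Embedding

/-! ### Dyadic cells and the compactness of the embedding -/

lemma measurableSet_dyadic (n k : ℕ) : MeasurableSet (dyadic n k) := measurableSet_Ioc

/-- The common endpoint of the two halves of a dyadic interval. -/
def dyadicMid (n k : ℕ) : ℝ := ((2 * k + 1 : ℕ) : ℝ) / 2 ^ (n + 1)

lemma two_mul_div_two_pow_succ (n k : ℕ) :
    ((2 * k : ℕ) : ℝ) / 2 ^ (n + 1) = (k : ℝ) / 2 ^ n := by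
  rw [pow_succ', Nat.cast_mul, Nat.cast_ofNat, mul_div_mul_left _ _ two_ne_zero]

lemma mem_dyadic_iff {n k : ℕ} {x : ℝ} :
    x ∈ dyadic n k ↔ (k : ℝ) < 2 ^ n * x ∧ 2 ^ n * x ≤ k + 1 := by
  have h2 : (0 : ℝ) < 2 ^ n := by positivity
  rw [dyadic, mem_Ioc, div_lt_iff₀' h2, le_div_iff₀' h2]

lemma dyadic_succ_union (n k : ℕ) :
    dyadic (n + 1) (2 * k) ∪ dyadic (n + 1) (2 * k + 1) = dyadic n k := by
  ext x
  simp only [mem_union, mem_dyadic_iff, pow_succ]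
  push_cast
  constructor <;> grind

lemma dyadic_disjoint {n j k : ℕ} (h : j ≠ k) : Disjoint (dyadic n j) (dyadic n k) := by
  wlog hjk : j < k generalizing j k
  · exact (this h.symm (lt_of_le_of_ne (not_lt.1 hjk) h.symm)).symm
  refine Ioc_disjoint_Ioc_of_le ?_
  have hsucc : (j : ℝ) + 1 ≤ k := by exact_mod_cast hjk
  gcongr

lemma dyadic_subset {n k : ℕ} (hk : k < 2 ^ n) : dyadic n k ⊆ Ioc (0 : ℝ) 1 := by
  refine Ioc_subset_Ioc (by positivity) ((div_le_one (by positivity)).2 ?_)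
  exact_mod_cast hk

lemma exists_mem_dyadic (n : ℕ) {x : ℝ} (hx : x ∈ Ioc (0 : ℝ) 1) :
    ∃ k < 2 ^ n, x ∈ dyadic n k := by
  have hpos : 0 < 2 ^ n * x := mul_pos (by positivity) hx.1
  obtain ⟨k, hk⟩ := Nat.exists_eq_succ_of_ne_zero (Nat.ceil_pos.2 hpos).ne'
  have hceil : k < ⌈2 ^ n * x⌉₊ ∧ ⌈2 ^ n * x⌉₊ ≤ k + 1 := by omega
  refine ⟨k, hceil.1.trans_le (Nat.ceil_le.2 ?_), mem_dyadic_iff.2 ⟨Nat.lt_ceil.1 hceil.1, ?_⟩⟩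
  · exact_mod_cast mul_le_of_le_one_right (by positivity) hx.2
  · exact_mod_cast Nat.ceil_le.1 hceil.2

lemma Ioc_eq_biUnion_dyadic (n : ℕ) :
    Ioc (0 : ℝ) 1 = ⋃ k ∈ Finset.range (2 ^ n), dyadic n k := by
  ext x
  simp only [mem_iUnion, Finset.mem_range, exists_prop]
  exact ⟨exists_mem_dyadic n, fun ⟨_, hk, hx⟩ => dyadic_subset hk hx⟩

section HeavyCells

variable (ν : Measure ℝ)

/-- The dyadic cells `C`, given by order and position, with `ν(C) Λ(C) ≥ t`. -/
def heavyCells (t : ℝ) : Set (ℕ × ℕ) :=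
  {p | p.2 < 2 ^ p.1 ∧ t ≤ ν.real (dyadic p.1 p.2) / 2 ^ p.1}

variable {ν} [IsFiniteMeasure ν] {t : ℝ}

lemma exists_forall_measure_dyadic_div_lt (ht : 0 < t) :
    ∃ N, ∀ n ≥ N, ∀ k, ν.real (dyadic n k) / 2 ^ n < t := by
  have hlim : Tendsto (fun n : ℕ => ν.real univ / 2 ^ n) atTop (𝓝 0) :=
    tendsto_const_nhds.div_atTop (tendsto_pow_atTop_atTop_of_one_lt one_lt_two)
  obtain ⟨N, hN⟩ := eventually_atTop.1 (hlim.eventually (gt_mem_nhds ht))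
  refine ⟨N, fun n hn k => lt_of_le_of_lt ?_ (hN n hn)⟩
  gcongr
  · exact measure_ne_top ν _
  · exact subset_univ _

lemma finite_heavyCells (ht : 0 < t) : (heavyCells ν t).Finite := by
  obtain ⟨N, hN⟩ := exists_forall_measure_dyadic_div_lt (ν := ν) ht
  refine (((Finset.range N) ×ˢ (Finset.range (2 ^ N))).finite_toSet).subset ?_
  rintro ⟨n, k⟩ ⟨hk, hheavy⟩
  have hn : n < N := by
    by_contra! h
    exact (hN n h k).not_ge hheavy
  simp only [Finset.coe_product, Finset.coe_range, mem_prod, mem_Iio]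
  exact ⟨hn, hk.trans_le (Nat.pow_le_pow_right two_pos hn.le)⟩

-- Bisect until the cells are light; every bisection of a heavy cell is at a zero of the primitive.
lemma setIntegral_dyadic_primitive_sq_le (g : UnitL2) {N : ℕ}
    (hN : ∀ k, ν.real (dyadic N k) / 2 ^ N < t)
    (hmid : ∀ p ∈ heavyCells ν t, primitive g (dyadicMid p.1 p.2) = 0) (m : ℕ) :
    ∀ n k : ℕ, n + m = N → k < 2 ^ n → primitive g ((k : ℝ) / 2 ^ n) = 0 →
      ∫ x in dyadic n k, primitive g x ^ 2 ∂ν ≤ t * ∫ x in dyadic n k, g x ^ 2 ∂unitMeasure := by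
  have hlight (n k : ℕ) (hle : ν.real (dyadic n k) / 2 ^ n ≤ t)
      (hleft : primitive g ((k : ℝ) / 2 ^ n) = 0) : ∫ x in dyadic n k, primitive g x ^ 2 ∂ν ≤
        t * ∫ x in dyadic n k, g x ^ 2 ∂unitMeasure := by
    refine (setIntegral_primitive_sq_le g (by positivity) hleft).trans
      (mul_le_mul_of_nonneg_right ?_ (integral_nonneg fun x => sq_nonneg _))
    rwa [← sub_div, add_sub_cancel_left, mul_one_div]
  induction m with
  | zero => exact fun n k hn _ hleft => hlight n k (by subst hn; exact (hN k).le) hleft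
  | succ m ih =>
    intro n k hn hk hleft
    by_cases hle : ν.real (dyadic n k) / 2 ^ n ≤ t
    · exact hlight n k hle hleft
    have hdisj : Disjoint (dyadic (n + 1) (2 * k)) (dyadic (n + 1) (2 * k + 1)) :=
      dyadic_disjoint (by omega)
    rw [← dyadic_succ_union,
      setIntegral_union hdisj (measurableSet_dyadic _ _)
        (integrable_primitive_sq ν g).integrableOn (integrable_primitive_sq ν g).integrableOn,
      setIntegral_union hdisj (measurableSet_dyadic _ _)
        (integrable_coe_sq g).integrableOn (integrable_coe_sq g).integrableOn, mul_add]
    refine add_le_add (ih (n + 1) (2 * k) (by omega) (by omega) ?_)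
      (ih (n + 1) (2 * k + 1) (by omega) (by omega) (hmid (n, k) ⟨hk, (not_le.1 hle).le⟩))
    rwa [two_mul_div_two_pow_succ]

lemma norm_embed_sq_le (hν : ν (Ioo (0 : ℝ) 1)ᶜ = 0) (ht : 0 < t) (g : UnitL2)
    (hmid : ∀ p ∈ heavyCells ν t, primitive g (dyadicMid p.1 p.2) = 0) :
    ‖embed ν g‖ ^ 2 ≤ t * ‖g‖ ^ 2 := by
  obtain ⟨N, hN⟩ := exists_forall_measure_dyadic_div_lt (ν := ν) ht
  have hunit := setIntegral_dyadic_primitive_sq_le g (hN N le_rfl) hmid N 0 0 (zero_add N)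
    (by norm_num) (by rw [Nat.cast_zero, zero_div, primitive_of_nonpos g le_rfl])
  have hrestrict : ν.restrict (dyadic 0 0) = ν := by
    refine Measure.restrict_eq_self_of_ae_mem ?_
    have hmem : ∀ᵐ x ∂ν, x ∈ Ioo (0 : ℝ) 1 := hν
    filter_upwards [hmem] with x hx
    simpa [dyadic] using Ioo_subset_Ioc_self hx
  rw [hrestrict, ← norm_embed_sq] at hunit
  exact hunit.trans (mul_le_mul_of_nonneg_left (setIntegral_sq_le_norm_sq g _) ht.le)

lemma isCompactOperator_embed (hν : ν (Ioo (0 : ℝ) 1)ᶜ = 0) : IsCompactOperator (embed ν) := by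
  refine isCompactOperator_of_norm_le_on_orthogonal _ fun ε hε => ?_
  refine ⟨(fun p : ℕ × ℕ => initialIndicator (dyadicMid p.1 p.2)) '' heavyCells ν (ε ^ 2),
    (finite_heavyCells (by positivity)).image _, fun u hu => ?_⟩
  refine le_of_sq_le_sq ?_ (by positivity)
  rw [mul_pow]
  exact norm_embed_sq_le hν (by positivity) u fun p hp => hu _ (mem_image_of_mem _ hp)

end HeavyCells

/-! ### The operator of the Dirichlet form -/

lemma exists_affine_of_chord {J : Set ℝ} {f : ℝ → ℝ} (h : ∀ a ∈ J, ∀ b ∈ J, ∀ c ∈ J,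
    a ≤ b → b ≤ c → (f b - f a) * (c - a) = (f c - f a) * (b - a)) :
    ∃ p q : ℝ, ∀ z ∈ J, f z = p * z + q := by
  rcases J.subsingleton_or_nontrivial with hJ | hJ
  · rcases J.eq_empty_or_nonempty with rfl | ⟨x, hx⟩
    · exact ⟨0, 0, by simp⟩
    · exact ⟨0, f x, fun z hz => by rw [hJ hz hx, zero_mul, zero_add]⟩
  obtain ⟨a, ha, b, hb, hab⟩ := hJ.exists_lt
  have hd : b - a ≠ 0 := (sub_pos.2 hab).ne'
  have hchord (z : ℝ) (hz : z ∈ J) : (f z - f a) * (b - a) = (f b - f a) * (z - a) := by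
    rcases le_total z a with hza | haz
    · linear_combination -(h z hz a ha b hb hza hab.le)
    rcases le_total z b with hzb | hbz
    · exact h a ha z hz b hb haz hzb
    · exact (h a ha b hb z hz hab.le hbz).symm
  refine ⟨(f b - f a) / (b - a), f a - (f b - f a) / (b - a) * a, fun z hz => ?_⟩
  field_simp
  linear_combination hchord z hz

section Operator

variable (ν : Measure ℝ)

/-- The derivatives of the functions in the form domain. Being affine off the support of `ν` is
encoded by three-point relations, each of which is a closed condition. -/
def derivDomain : Submodule ℝ UnitL2 where
  carrier := {g | primitive g 1 = 0 ∧ ∀ a b c : ℝ, a ≤ b → b ≤ c → Icc a c ⊆ Icc 0 1 \ ν.support →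
    (primitive g b - primitive g a) * (c - a) = (primitive g c - primitive g a) * (b - a)}
  add_mem' {g h} hg hh := by
    refine ⟨by simp [hg.1, hh.1], fun a b c hab hbc hs => ?_⟩
    simp only [map_add, Pi.add_apply]
    linear_combination hg.2 a b c hab hbc hs + hh.2 a b c hab hbc hs
  zero_mem' := by simp
  smul_mem' r g hg := by
    refine ⟨by simp [hg.1], fun a b c hab hbc hs => ?_⟩
    simp only [map_smul, Pi.smul_apply, smul_eq_mul]
    linear_combination r * hg.2 a b c hab hbc hs

lemma isClosed_derivDomain : IsClosed (derivDomain ν : Set UnitL2) := by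
  have hcont (x : ℝ) : Continuous fun g : UnitL2 => primitive g x := by
    simp only [primitive_apply]
    fun_prop
  simp only [derivDomain, Submodule.coe_set_mk, AddSubmonoid.coe_set_mk, AddSubsemigroup.coe_set_mk,
    ofPred_and, ofPred_forall]
  refine (isClosed_eq (hcont 1) continuous_const).inter ?_
  refine isClosed_iInter fun a => isClosed_iInter fun b => isClosed_iInter fun c =>
    isClosed_iInter fun _ => isClosed_iInter fun _ => isClosed_iInter fun _ => ?_
  exact isClosed_eq (((hcont b).sub (hcont a)).mul_const _) (((hcont c).sub (hcont a)).mul_const _)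

instance : CompleteSpace (derivDomain ν) := (isClosed_derivDomain ν).completeSpace_coe

variable {ν}

lemma primitive_mem_formDomain_iff {g : UnitL2} :
    primitive g ∈ formDomain ν ↔ g ∈ derivDomain ν := by
  constructor
  · rintro ⟨-, -, h1, -, haff⟩
    refine ⟨h1, fun a b c hab hbc hs => ?_⟩
    obtain ⟨p, q, hpq⟩ := haff (Icc a c) ordConnected_Icc hs
    rw [hpq a ⟨le_rfl, hab.trans hbc⟩, hpq b ⟨hab, hbc⟩, hpq c ⟨hab.trans hbc, le_rfl⟩]
    ring
  · rintro ⟨h1, haff⟩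
    exact ⟨⟨g, hasWeakDeriv_primitive g⟩, primitive_of_nonpos g le_rfl, h1,
      fun x hx => primitive_eq_zero_of_notMem_Icc g h1 hx, fun J hJ hJs => exists_affine_of_chord
        fun a ha b _ c hc hab hbc => haff a b c hab hbc ((hJ.out ha hc).trans hJs)⟩

lemma mem_formDomain_iff {f : ℝ → ℝ} : f ∈ formDomain ν ↔ ∃ g ∈ derivDomain ν, primitive g = f := by
  constructor
  · intro hf
    obtain ⟨g, rfl⟩ := exists_eq_primitive hf.1 hf.2.1 hf.2.2.1 hf.2.2.2.1
    exact ⟨g, primitive_mem_formDomain_iff.1 hf, rfl⟩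
  · rintro ⟨g, hg, rfl⟩
    exact primitive_mem_formDomain_iff.2 hg

variable (ν) [IsFiniteMeasure ν]

/-- The self-adjoint operator on `derivDomain ν` whose nonzero eigenvalues are the reciprocals of
the eigenvalues of the form. -/
def formOperator : derivDomain ν →L[ℝ] derivDomain ν :=
  (embed ν ∘L (derivDomain ν).subtypeL).adjoint ∘L embed ν ∘L (derivDomain ν).subtypeL

lemma inner_formOperator (g h : derivDomain ν) :
    inner ℝ (formOperator ν g) h = inner ℝ (embed ν g) (embed ν h) := by
  rw [formOperator, ContinuousLinearMap.comp_apply, ContinuousLinearMap.adjoint_inner_left]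
  rfl

lemma reApplyInnerSelf_formOperator (g : derivDomain ν) :
    (formOperator ν).reApplyInnerSelf g = ‖embed ν g‖ ^ 2 := by
  rw [ContinuousLinearMap.reApplyInnerSelf_apply, inner_formOperator, RCLike.re_to_real,
    real_inner_self_eq_norm_sq]

lemma isSymmetric_formOperator :
    (formOperator ν : derivDomain ν →ₗ[ℝ] derivDomain ν).IsSymmetric :=
  (ContinuousLinearMap.isPositive_adjoint_comp_self _).isSymmetric

variable {ν}

lemma isCompactOperator_formOperator (hν : ν (Ioo (0 : ℝ) 1)ᶜ = 0) :
    IsCompactOperator (formOperator ν) :=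
  ((isCompactOperator_embed hν).comp_clm (derivDomain ν).subtypeL).clm_comp
    (embed ν ∘L (derivDomain ν).subtypeL).adjoint

lemma isEigenfunction_primitive_iff {lam : ℝ} {g : derivDomain ν} :
    IsEigenfunction ν lam (primitive g) ↔ g ≠ 0 ∧ lam • formOperator ν g = g := by
  have hne : primitive g ≠ 0 ↔ g ≠ 0 := by
    rw [← map_zero primitive, primitive_injective.ne_iff, ne_eq, ZeroMemClass.coe_eq_zero]
  have hform (h : derivDomain ν) : lam * ∫ t, primitive g t * primitive h t ∂ν =
      inner ℝ (lam • formOperator ν g) h := by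
    rw [← inner_embed, ← inner_formOperator]
    exact (real_inner_smul_left _ _ _).symm
  have hweak : (∀ h ∈ formDomain ν, energy (primitive g) h =
      lam * ∫ t, primitive g t * h t ∂ν) ↔ lam • formOperator ν g = g := by
    rw [ext_iff_inner_right ℝ]
    constructor
    · intro h u
      rw [← hform, ← h _ (primitive_mem_formDomain_iff.2 u.2), energy_primitive]
      rfl
    · intro h f hf
      obtain ⟨u, hu, rfl⟩ := mem_formDomain_iff.1 hf
      rw [hform ⟨u, hu⟩, h, energy_primitive]
      rfl
  rw [IsEigenfunction, hne, hweak, and_iff_right (primitive_mem_formDomain_iff.2 g.2)]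

lemma pos_of_smul_formOperator_eq {lam : ℝ} {g : derivDomain ν} (hg : g ≠ 0)
    (h : lam • formOperator ν g = g) : 0 < lam := by
  have hnorm : lam * ‖embed ν g‖ ^ 2 = ‖g‖ ^ 2 := by
    rw [← real_inner_self_eq_norm_sq, ← inner_formOperator, ← real_inner_smul_left, h,
      real_inner_self_eq_norm_sq]
  have hpos : 0 < ‖g‖ ^ 2 := by positivity
  exact pos_of_mul_pos_left (hnorm ▸ hpos) (sq_nonneg _)

lemma eigenvalueCount_eq_finrank {x : ℝ} (hx : 0 < x) :
    eigenvalueCount ν x = Module.finrank ℝ (spectralSubspace (formOperator ν) (Ici x⁻¹)) := by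
  set P := primitive ∘ₗ (derivDomain ν).subtype
  have hP : Function.Injective P := primitive_injective.comp Subtype.val_injective
  have hspan : Submodule.span ℝ {f : ℝ → ℝ | ∃ lam ≤ x, IsEigenfunction ν lam f} =
      (spectralSubspace (formOperator ν) (Ici x⁻¹)).map P := by
    apply le_antisymm
    · rw [Submodule.span_le]
      rintro f ⟨lam, hlam, hf⟩
      obtain ⟨g, hg, rfl⟩ := mem_formDomain_iff.1 hf.1
      obtain ⟨hg0, hA⟩ := isEigenfunction_primitive_iff (g := ⟨g, hg⟩).1 hf
      have hpos := pos_of_smul_formOperator_eq hg0 hA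
      refine ⟨⟨g, hg⟩, eigenspace_le_spectralSubspace (inv_anti₀ hpos hlam) ?_, rfl⟩
      exact Module.End.mem_eigenspace_iff.2 ((eq_inv_smul_iff₀ hpos.ne').2 hA)
    · rw [spectralSubspace, Submodule.map_iSup, iSup_le_iff]
      rintro ⟨μ, hμ⟩ f ⟨g, hg, rfl⟩
      rcases eq_or_ne g 0 with rfl | hg0
      · rw [map_zero]
        exact zero_mem _
      have hμ0 : 0 < μ := (inv_pos.2 hx).trans_le hμ
      refine Submodule.subset_span ⟨μ⁻¹, inv_le_of_inv_le₀ hx hμ, ?_⟩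
      exact isEigenfunction_primitive_iff.2
        ⟨hg0, (inv_smul_eq_iff₀ hμ0.ne').2 (Module.End.mem_eigenspace_iff.1 hg)⟩
  rw [eigenvalueCount, hspan]
  exact (Submodule.equivMapOfInjective P hP _).finrank_eq.symm

variable (ν) in
/-- Evaluation of the primitive at the midpoints of the heavy cells. -/
def midpointValues (t : ℝ) : derivDomain ν →ₗ[ℝ] heavyCells ν t → ℝ :=
  LinearMap.funLeft ℝ ℝ (fun p : heavyCells ν t => dyadicMid p.1.1 p.1.2) ∘ₗ
    primitive ∘ₗ (derivDomain ν).subtype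

lemma injective_midpointValues (hν : ν (Ioo (0 : ℝ) 1)ᶜ = 0) {t c : ℝ} (ht : 0 < t) (htc : t < c) :
    Function.Injective
      ((midpointValues ν t).domRestrict (spectralSubspace (formOperator ν) (Ici c))) := by
  refine injective_domRestrict_spectralSubspace (isSymmetric_formOperator ν) _ fun g hg hmid => ?_
  rw [reApplyInnerSelf_formOperator]
  calc ‖embed ν g‖ ^ 2 ≤ t * ‖g‖ ^ 2 := norm_embed_sq_le hν ht g fun p hp => congrFun hmid ⟨p, hp⟩
    _ < c * ‖g‖ ^ 2 := by gcongr

lemma finiteDimensional_spectralSubspace (hν : ν (Ioo (0 : ℝ) 1)ᶜ = 0) {c : ℝ} (hc : 0 < c) :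
    FiniteDimensional ℝ (spectralSubspace (formOperator ν) (Ici c)) := by
  have : Finite (heavyCells ν (c / 2)) := (finite_heavyCells (half_pos hc)).to_subtype
  exact .of_injective _ (injective_midpointValues hν (half_pos hc) (half_lt_self hc))

lemma eigenvalueCount_le_ncard_heavyCells (hν : ν (Ioo (0 : ℝ) 1)ᶜ = 0) {t x : ℝ} (ht : 0 < t)
    (hx : 0 < x) (htx : t * x < 1) : eigenvalueCount ν x ≤ (heavyCells ν t).ncard := by
  have : Fintype (heavyCells ν t) := (finite_heavyCells ht).fintype
  have htc : t < x⁻¹ := by rwa [lt_inv_comm₀ ht hx, lt_inv_comm₀ hx ht, ← one_div, lt_div_iff₀ hx]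
  rw [eigenvalueCount_eq_finrank hx, ← Nat.card_coe_set_eq, Nat.card_eq_fintype_card,
    ← Module.finrank_fintype_fun_eq_card ℝ]
  exact LinearMap.finrank_le_finrank_of_injective (injective_midpointValues hν ht htc)

end Operator

/-! ### Trapezoidal test functions -/

lemma primitive_initialIndicator {x y : ℝ} (hx : 0 ≤ x) (hy : y ∈ Icc (0 : ℝ) 1) :
    primitive (initialIndicator y) x = min x y := by
  rw [primitive_apply, initialIndicator, initialIndicator,
    L2.inner_indicatorConstLp_indicatorConstLp measurableSet_Ioc measurableSet_Ioc,
    Ioc_inter_Ioc, max_self]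
  have hsub : Ioc 0 (min x y) ∩ Icc 0 1 = Ioc (0 : ℝ) (min x y) :=
    inter_eq_left.2 fun t ht => ⟨ht.1.le, ht.2.trans ((min_le_right _ _).trans hy.2)⟩
  rw [Measure.real, Measure.restrict_apply measurableSet_Ioc, hsub, Real.volume_Ioc,
    sub_zero, ENNReal.toReal_ofReal (le_min hx hy.1)]
  simp

/-- The piecewise affine function that is `1` on `[k,k+1]` and `0` off `[k-1,k+2]`. -/
def trapezoid (k z : ℝ) : ℝ := (min z k - min z (k - 1)) - (min z (k + 2) - min z (k + 1))

lemma trapezoid_eq_one {k z : ℝ} (h1 : k ≤ z) (h2 : z ≤ k + 1) : trapezoid k z = 1 := by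
  grind [trapezoid]

lemma trapezoid_eq_zero {k z : ℝ} (h : z ≤ k - 1 ∨ k + 2 ≤ z) : trapezoid k z = 0 := by
  grind [trapezoid]

/-- The derivative of the trapezoidal function that is `1` on the dyadic interval
`(k 2⁻ⁿ, (k+1) 2⁻ⁿ]` and `0` off the union of this interval and its two neighbours. -/
def trapezoidDeriv (n k : ℕ) : UnitL2 :=
  (2 : ℝ) ^ n • ((initialIndicator ((k : ℝ) / 2 ^ n) - initialIndicator (((k : ℝ) - 1) / 2 ^ n)) -
    (initialIndicator (((k : ℝ) + 2) / 2 ^ n) - initialIndicator (((k : ℝ) + 1) / 2 ^ n)))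

/-- The cells whose two neighbours of the same order lie in `(0,1]`. -/
def InnerCell (n k : ℕ) : Prop := 1 ≤ k ∧ k + 2 ≤ 2 ^ n

/-- A set of inner cells of order `n`, any two of which have at least two cells between them. -/
def SeparatedCells (n : ℕ) (K : Finset ℕ) : Prop :=
  (∀ k ∈ K, InnerCell n k) ∧ (K : Set ℕ).Pairwise fun j k => j + 3 ≤ k ∨ k + 3 ≤ j

section Trapezoid

variable {n j k : ℕ}

lemma trapezoid_eq_zero_of_separated (h : j + 3 ≤ k ∨ k + 3 ≤ j) {z : ℝ}
    (hz : z ∈ Icc (j - 1 : ℝ) (j + 2)) :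
    trapezoid k z = 0 := by
  refine trapezoid_eq_zero (h.imp (fun h => ?_) fun h => ?_)
  · have hjk : (j : ℝ) + 3 ≤ k := by exact_mod_cast h
    linarith [hz.2]
  · have hkj : (k : ℝ) + 3 ≤ j := by exact_mod_cast h
    linarith [hz.1]

lemma primitive_trapezoidDeriv (hk : InnerCell n k) {x : ℝ} (hx : 0 ≤ x) :
    primitive (trapezoidDeriv n k) x = trapezoid k (2 ^ n * x) := by
  have hk1 : (1 : ℝ) ≤ k := by exact_mod_cast hk.1
  have hk2 : (k : ℝ) + 2 ≤ 2 ^ n := by exact_mod_cast hk.2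
  have hmin (a : ℝ) (ha : 0 ≤ a) (ha' : a ≤ 2 ^ n) :
      min (2 ^ n * x) a = 2 ^ n * primitive (initialIndicator (a / 2 ^ n)) x := by
    rw [primitive_initialIndicator hx ⟨by positivity, (div_le_one (by positivity)).2 ha'⟩,
      mul_min_of_nonneg _ _ (by positivity), mul_div_cancel₀ _ (by positivity)]
  rw [trapezoid, hmin k (by linarith) (by linarith), hmin (k - 1) (by linarith) (by linarith),
    hmin (k + 2) (by linarith) (by linarith), hmin (k + 1) (by linarith) (by linarith)]
  simp only [trapezoidDeriv, map_smul, map_sub, Pi.smul_apply, Pi.sub_apply, smul_eq_mul]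
  ring

lemma inner_trapezoidDeriv (hj : 1 ≤ j) (hk : InnerCell n k) :
    inner ℝ (trapezoidDeriv n j) (trapezoidDeriv n k) =
      2 ^ n * ((trapezoid k j - trapezoid k (j - 1)) -
        (trapezoid k (j + 2) - trapezoid k (j + 1))) := by
  have hj1 : (1 : ℝ) ≤ j := by exact_mod_cast hj
  have heval (a : ℝ) (ha : 0 ≤ a) :
      inner ℝ (initialIndicator (a / 2 ^ n)) (trapezoidDeriv n k) = trapezoid k a := by
    rw [← primitive_apply, primitive_trapezoidDeriv hk (by positivity),
      mul_div_cancel₀ _ (by positivity)]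
  rw [trapezoidDeriv, real_inner_smul_left, inner_sub_left, inner_sub_left, inner_sub_left,
    heval j (by linarith), heval (j - 1) (by linarith), heval (j + 2) (by linarith),
    heval (j + 1) (by linarith)]

lemma inner_trapezoidDeriv_self (hk : InnerCell n k) :
    inner ℝ (trapezoidDeriv n k) (trapezoidDeriv n k) = 2 * 2 ^ n := by
  rw [inner_trapezoidDeriv hk.1 hk, trapezoid_eq_one le_rfl (by linarith),
    trapezoid_eq_zero (.inl le_rfl), trapezoid_eq_zero (.inr le_rfl),
    trapezoid_eq_one (by linarith) le_rfl]
  ring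

lemma inner_trapezoidDeriv_of_separated (hj : 1 ≤ j) (hk : InnerCell n k)
    (h : j + 3 ≤ k ∨ k + 3 ≤ j) : inner ℝ (trapezoidDeriv n j) (trapezoidDeriv n k) = 0 := by
  rw [inner_trapezoidDeriv hj hk, trapezoid_eq_zero_of_separated h (by constructor <;> linarith),
    trapezoid_eq_zero_of_separated h (by constructor <;> linarith),
    trapezoid_eq_zero_of_separated h (by constructor <;> linarith),
    trapezoid_eq_zero_of_separated h (by constructor <;> linarith)]
  ring

end Trapezoid

/-- Linear combinations of derivatives of trapezoidal functions. -/
def trapezoidCombination (n : ℕ) (K : Finset ℕ) : (K → ℝ) →ₗ[ℝ] UnitL2 :=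
  Fintype.linearCombination ℝ (fun k : K => trapezoidDeriv n k)

section TestFunctions

variable {n : ℕ} {K : Finset ℕ}

lemma norm_trapezoidCombination_sq (hK : SeparatedCells n K) (c : K → ℝ) :
    ‖trapezoidCombination n K c‖ ^ 2 = 2 * 2 ^ n * ∑ k, c k ^ 2 := by
  rw [← real_inner_self_eq_norm_sq, trapezoidCombination, Fintype.linearCombination_apply,
    sum_inner, Finset.mul_sum]
  refine Finset.sum_congr rfl fun k _ => ?_
  rw [inner_sum, Fintype.sum_eq_single k]
  · rw [real_inner_smul_left, real_inner_smul_right, inner_trapezoidDeriv_self (hK.1 k k.2)]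
    ring
  · intro j hj
    rw [real_inner_smul_left, real_inner_smul_right, inner_trapezoidDeriv_of_separated
      (hK.1 k k.2).1 (hK.1 j j.2) (hK.2 k.2 j.2 (Subtype.coe_ne_coe.2 hj.symm)), mul_zero, mul_zero]

lemma primitive_trapezoidCombination (hK : ∀ k ∈ K, InnerCell n k) (c : K → ℝ) {x : ℝ}
    (hx : 0 ≤ x) :
    primitive (trapezoidCombination n K c) x = ∑ k, c k * trapezoid (k : ℕ) (2 ^ n * x) := by
  rw [trapezoidCombination, Fintype.linearCombination_apply, map_sum, Finset.sum_apply]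
  refine Finset.sum_congr rfl fun k _ => ?_
  rw [map_smul, Pi.smul_apply, smul_eq_mul, primitive_trapezoidDeriv (hK k k.2) hx]

lemma primitive_trapezoidCombination_of_mem (hK : SeparatedCells n K) (c : K → ℝ) {x : ℝ} (j : K)
    (hx : x ∈ dyadic n j) : primitive (trapezoidCombination n K c) x = c j := by
  have hx0 : 0 ≤ x := le_trans (by positivity) hx.1.le
  rw [mem_dyadic_iff] at hx
  rw [primitive_trapezoidCombination hK.1 c hx0, Fintype.sum_eq_single j]
  · rw [trapezoid_eq_one hx.1.le hx.2, mul_one]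
  · intro k hk
    rw [trapezoid_eq_zero_of_separated (hK.2 j.2 k.2 (Subtype.coe_ne_coe.2 hk.symm))
      ⟨by linarith, by linarith⟩, mul_zero]

lemma primitive_trapezoidCombination_one (hK : ∀ k ∈ K, InnerCell n k) (c : K → ℝ) :
    primitive (trapezoidCombination n K c) 1 = 0 := by
  rw [primitive_trapezoidCombination hK c zero_le_one]
  refine Finset.sum_eq_zero fun k _ => ?_
  have hk : ((k : ℕ) : ℝ) + 2 ≤ 2 ^ n := by exact_mod_cast (hK k k.2).2
  rw [mul_one, trapezoid_eq_zero (.inr hk), mul_zero]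

variable {ν : Measure ℝ}

lemma support_subset_Icc (hν : ν (Ioo (0 : ℝ) 1)ᶜ = 0) : ν.support ⊆ Icc 0 1 := by
  refine Measure.support_subset_of_isClosed isClosed_Icc ?_
  have hmem : ∀ᵐ x ∂ν, x ∈ Ioo (0 : ℝ) 1 := hν
  filter_upwards [hmem] with x hx using Ioo_subset_Icc_self hx

/-- The derivative of the Green function of the second derivative with pole `x`. -/
def greenDeriv (x : ℝ) : UnitL2 := initialIndicator x - x • initialIndicator 1

lemma inner_greenDeriv {g : UnitL2} (hg : primitive g 1 = 0) (x : ℝ) :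
    inner ℝ (greenDeriv x) g = primitive g x := by
  rw [greenDeriv, inner_sub_left, real_inner_smul_left, ← primitive_apply, ← primitive_apply, hg,
    mul_zero, sub_zero]

lemma greenDeriv_mem_derivDomain {x : ℝ} (hx : x ∈ ν.support) (hx' : x ∈ Icc (0 : ℝ) 1) :
    greenDeriv x ∈ derivDomain ν := by
  have hval (z : ℝ) (hz : z ∈ Icc (0 : ℝ) 1) : primitive (greenDeriv x) z = min z x - x * z := by
    simp only [greenDeriv, map_sub, map_smul, Pi.sub_apply, Pi.smul_apply, smul_eq_mul]
    rw [primitive_initialIndicator hz.1 hx',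
      primitive_initialIndicator hz.1 ⟨zero_le_one, le_rfl⟩, min_eq_left hz.2]
  refine ⟨by rw [hval 1 ⟨zero_le_one, le_rfl⟩, min_eq_right hx'.2]; ring,
    fun a b c hab hbc hs => ?_⟩
  have hxn : x ∉ Icc a c := fun h => (hs h).2 hx
  rw [hval a (hs ⟨le_rfl, hab.trans hbc⟩).1, hval b (hs ⟨hab, hbc⟩).1,
    hval c (hs ⟨hab.trans hbc, le_rfl⟩).1]
  rcases not_and_or.1 hxn with h | h <;> rw [not_le] at h
  · rw [min_eq_right (by linarith), min_eq_right (by linarith), min_eq_right (by linarith)]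
    ring
  · rw [min_eq_left (by linarith), min_eq_left (by linarith), min_eq_left (by linarith)]
    ring

variable [IsFiniteMeasure ν]

lemma le_norm_embed_trapezoidCombination_sq (hK : SeparatedCells n K) (c : K → ℝ) {m : ℝ}
    (hm : ∀ k ∈ K, m ≤ ν.real (dyadic n k)) :
    m * ∑ k, c k ^ 2 ≤ ‖embed ν (trapezoidCombination n K c)‖ ^ 2 := by
  set g := trapezoidCombination n K c with hg
  have hdisj : Pairwise fun i j : K => Disjoint (dyadic n i) (dyadic n j) := fun i j hij =>
    dyadic_disjoint (Subtype.coe_ne_coe.2 hij)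
  have hcell (k : K) : ∫ x in dyadic n k, primitive g x ^ 2 ∂ν =
      ν.real (dyadic n k) * c k ^ 2 := by
    rw [← smul_eq_mul, ← setIntegral_const]
    refine setIntegral_congr_fun (measurableSet_dyadic n k) fun x hx => ?_
    rw [hg, primitive_trapezoidCombination_of_mem hK c k hx]
  calc m * ∑ k, c k ^ 2 ≤ ∑ k : K, ∫ x in dyadic n k, primitive g x ^ 2 ∂ν := by
        rw [Finset.mul_sum]
        refine Finset.sum_le_sum fun k _ => ?_
        rw [hcell]
        exact mul_le_mul_of_nonneg_right (hm k k.2) (sq_nonneg _)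
    _ = ∫ x in ⋃ k : K, dyadic n k, primitive g x ^ 2 ∂ν :=
        (integral_iUnion_fintype (fun k : K => measurableSet_dyadic n k) hdisj
          fun k => (integrable_primitive_sq ν g).integrableOn).symm
    _ ≤ ∫ x, primitive g x ^ 2 ∂ν :=
        setIntegral_le_integral (integrable_primitive_sq ν g) (ae_of_all _ fun x => sq_nonneg _)
    _ = ‖embed ν g‖ ^ 2 := (norm_embed_sq ν g).symm

-- The Green functions with pole in the support span the orthogonal complement of the functions
-- that vanish on the support, so these are invisible to the projection.
lemma embed_starProjection_derivDomain (hν : ν (Ioo (0 : ℝ) 1)ᶜ = 0) {g : UnitL2}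
    (hg : primitive g 1 = 0) : embed ν ((derivDomain ν).starProjection g) = embed ν g := by
  set v := (derivDomain ν).starProjection g
  have hv : primitive v 1 = 0 := ((derivDomain ν).starProjection_apply_mem g).1
  have hsupp (x : ℝ) (hx : x ∈ ν.support) : primitive v x = primitive g x := by
    have horth := Submodule.starProjection_inner_eq_zero g _
      (greenDeriv_mem_derivDomain hx (support_subset_Icc hν hx))
    rw [real_inner_comm, inner_sub_right, inner_greenDeriv hg, inner_greenDeriv hv] at horth
    exact (sub_eq_zero.1 horth).symm
  refine Lp.ext ?_
  filter_upwards [coeFn_embed ν v, coeFn_embed ν g, Measure.support_mem_ae (μ := ν)]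
    with x hvx hgx hx
  rw [hvx, hgx, hsupp x hx]

lemma card_le_eigenvalueCount (hν : ν (Ioo (0 : ℝ) 1)ᶜ = 0) (hK : SeparatedCells n K) {m x : ℝ}
    (hm : ∀ k ∈ K, m ≤ ν.real (dyadic n k)) (hx : 0 < x) (hmx : 2 * 2 ^ n < m * x) :
    K.card ≤ eigenvalueCount ν x := by
  have : FiniteDimensional ℝ (spectralSubspace (formOperator ν) (Ici x⁻¹)) :=
    finiteDimensional_spectralSubspace hν (inv_pos.2 hx)
  rw [eigenvalueCount_eq_finrank hx, ← Fintype.card_coe, ← Module.finrank_fintype_fun_eq_card ℝ]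
  refine finrank_le_finrank_spectralSubspace (isSymmetric_formOperator ν)
    (isCompactOperator_formOperator hν)
    ((derivDomain ν).orthogonalProjectionOnto.toLinearMap ∘ₗ trapezoidCombination n K)
    fun c hc => ?_
  set g := trapezoidCombination n K c
  have hsum : 0 < ∑ k, c k ^ 2 := by
    obtain ⟨k, hk⟩ := Function.ne_iff.1 hc
    exact Finset.sum_pos' (fun k _ => sq_nonneg _) ⟨k, Finset.mem_univ _, pow_two_pos_of_ne_zero hk⟩
  have hproj : ‖(derivDomain ν).orthogonalProjectionOnto g‖ ≤ ‖g‖ :=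
    Submodule.norm_orthogonalProjectionOnto_apply_le _ _
  rw [reApplyInnerSelf_formOperator]
  calc x⁻¹ * ‖(derivDomain ν).orthogonalProjectionOnto g‖ ^ 2 ≤ x⁻¹ * ‖g‖ ^ 2 := by gcongr
    _ = x⁻¹ * (2 * 2 ^ n) * ∑ k, c k ^ 2 := by rw [norm_trapezoidCombination_sq hK, ← mul_assoc]
    _ < m * ∑ k, c k ^ 2 := by
        gcongr
        rwa [inv_mul_lt_iff₀ hx, mul_comm x]
    _ ≤ ‖embed ν g‖ ^ 2 := le_norm_embed_trapezoidCombination_sq hK c hm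
    _ = ‖embed ν ((derivDomain ν).starProjection g)‖ ^ 2 := by
        rw [embed_starProjection_derivDomain hν (primitive_trapezoidCombination_one hK.1 c)]

end TestFunctions

section Separation

variable {n : ℕ} {K : Finset ℕ}

open Classical in
lemma card_le_card_filter_innerCell_add_two (hK : ∀ k ∈ K, k < 2 ^ n) :
    K.card ≤ (K.filter fun k => InnerCell n k).card + 2 := by
  have hsub : K ⊆ (K.filter fun k => InnerCell n k) ∪ {0, 2 ^ n - 1} := by
    intro k hk
    have hlt := hK k hk
    by_cases hinner : InnerCell n k
    · exact Finset.mem_union_left _ (Finset.mem_filter.2 ⟨hk, hinner⟩)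
    · simp only [InnerCell] at hinner
      simp only [Finset.mem_union, Finset.mem_insert, Finset.mem_singleton]
      omega
  exact (Finset.card_le_card hsub).trans ((Finset.card_union_le _ _).trans
    (Nat.add_le_add_left Finset.card_le_two _))

lemma exists_card_le_three_mul_card_filter_mod (K : Finset ℕ) :
    ∃ r, K.card ≤ 3 * (K.filter fun k => k % 3 = r).card := by
  by_contra! h
  have hsum : K.card = ∑ r ∈ Finset.range 3, (K.filter fun k => k % 3 = r).card :=
    Finset.card_eq_sum_card_fiberwise fun k _ => by simpa using Nat.mod_lt k three_pos
  have h0 := h 0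
  have h1 := h 1
  have h2 := h 2
  simp only [Finset.sum_range_succ, Finset.sum_range_zero] at hsum
  omega

lemma exists_separatedCells (hK : ∀ k ∈ K, k < 2 ^ n) :
    ∃ K' ⊆ K, SeparatedCells n K' ∧ K.card ≤ 3 * K'.card + 2 := by
  classical
  have hinner := card_le_card_filter_innerCell_add_two hK
  obtain ⟨r, hr⟩ := exists_card_le_three_mul_card_filter_mod (K.filter fun k => InnerCell n k)
  refine ⟨_, (Finset.filter_subset _ _).trans (Finset.filter_subset _ _),
    ⟨fun k hk => ?_, fun j hj k hk hjk => ?_⟩, hinner.trans (by gcongr)⟩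
  · exact (Finset.mem_filter.1 (Finset.mem_filter.1 hk).1).2
  · have hjr := (Finset.mem_filter.1 hj).2
    have hkr := (Finset.mem_filter.1 hk).2
    omega

end Separation

/-! ### The `L^q`-spectrum -/

/-- A nonzero measure carried by the open unit interval. -/
structure UnitSupported (ν : Measure ℝ) : Prop where
  ne_zero : ν ≠ 0
  compl_eq_zero : ν (Ioo (0 : ℝ) 1)ᶜ = 0

lemma convexOn_log_sum_rpow {ι : Type*} {s : Finset ι} (hs : s.Nonempty) {a : ι → ℝ}
    (ha : ∀ i ∈ s, 0 < a i) : ConvexOn ℝ univ fun q : ℝ => Real.log (∑ i ∈ s, a i ^ q) := by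
  have hpos (q : ℝ) : 0 < ∑ i ∈ s, a i ^ q :=
    Finset.sum_pos (fun i hi => Real.rpow_pos_of_pos (ha i hi) q) hs
  refine convexOn_iff_forall_pos.2 ⟨convex_univ, fun q _ r _ b c hb hc hbc => ?_⟩
  have hpow {d : ℝ} (hd : 0 < d) (t : ℝ) :
      ∑ i ∈ s, (a i ^ (d * t)) ^ d⁻¹ = ∑ i ∈ s, a i ^ t := by
    refine Finset.sum_congr rfl fun i hi => ?_
    rw [← Real.rpow_mul (ha i hi).le, mul_comm d t, mul_inv_cancel_right₀ hd.ne']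
  have hholder := Real.inner_le_Lp_mul_Lq_of_nonneg s
    (f := fun i => a i ^ (b * q)) (g := fun i => a i ^ (c * r))
    (Real.HolderConjugate.inv_inv hb hc hbc)
    (fun i hi => (Real.rpow_pos_of_pos (ha i hi) _).le)
    (fun i hi => (Real.rpow_pos_of_pos (ha i hi) _).le)
  rw [hpow hb, hpow hc, one_div, one_div, inv_inv, inv_inv,
    ← Finset.sum_congr rfl fun i hi => Real.rpow_add (ha i hi) (b * q) (c * r)] at hholder
  refine (Real.log_le_log (hpos _) hholder).trans_eq ?_
  rw [Real.log_mul (Real.rpow_pos_of_pos (hpos q) b).ne' (Real.rpow_pos_of_pos (hpos r) c).ne',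
    Real.log_rpow (hpos q), Real.log_rpow (hpos r), smul_eq_mul, smul_eq_mul]

section Partition

variable {ν : Measure ℝ} {n k : ℕ} {q r : ℝ}

open Classical in
/-- The positions of the dyadic intervals of order `n` in `(0,1]` with positive measure. -/
def cells (ν : Measure ℝ) (n : ℕ) : Finset ℕ :=
  (Finset.range (2 ^ n)).filter (fun k => 0 < ν (dyadic n k))

/-- The mass of a dyadic interval, as a real number. -/
abbrev mass (ν : Measure ℝ) (n k : ℕ) : ℝ := ν.real (dyadic n k)

/-- The partition function `∑ ν(C)^q` at scale `2⁻ⁿ`. -/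
def partitionSum (ν : Measure ℝ) (n : ℕ) (q : ℝ) : ℝ := ∑ k ∈ cells ν n, mass ν n k ^ q

/-- The exponent of the total mass at scale `2⁻ⁿ`, an error term that vanishes for probability
measures and tends to `0` in general. -/
def massExponent (ν : Measure ℝ) (n : ℕ) : ℝ := Real.log (ν.real univ) / Real.log (2 ^ n)

lemma betaN_eq (n : ℕ) (q : ℝ) :
    betaN ν n q = Real.log (partitionSum ν n q) / Real.log (2 ^ n) := rfl

lemma lt_of_mem_cells (hk : k ∈ cells ν n) : k < 2 ^ n := by
  classical
  exact Finset.mem_range.1 (Finset.mem_filter.1 hk).1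

lemma card_cells_le (n : ℕ) : (cells ν n).card ≤ 2 ^ n :=
  (Finset.card_le_card fun _ hk => Finset.mem_range.2 (lt_of_mem_cells hk)).trans_eq
    (Finset.card_range _)

lemma partitionSum_zero (n : ℕ) : partitionSum ν n 0 = (cells ν n).card := by
  simp [partitionSum]

lemma betaN_zero_nonneg (n : ℕ) : 0 ≤ betaN ν n 0 := by
  rw [betaN_eq, partitionSum_zero]
  exact div_nonneg (Real.log_natCast_nonneg _) (Real.log_nonneg (one_le_pow₀ one_le_two))

lemma log_two_pow_pos (hn : n ≠ 0) : 0 < Real.log ((2 : ℝ) ^ n) :=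
  Real.log_pos (one_lt_pow₀ (by norm_num) hn)

lemma tendsto_log_two_pow : Tendsto (fun n : ℕ => Real.log ((2 : ℝ) ^ n)) atTop atTop :=
  Real.tendsto_log_atTop.comp (tendsto_pow_atTop_atTop_of_one_lt one_lt_two)

lemma tendsto_massExponent : Tendsto (massExponent ν) atTop (𝓝 0) :=
  tendsto_log_two_pow.const_div_atTop _

lemma UnitSupported.ae_mem (h : UnitSupported ν) : ∀ᵐ x ∂ν, x ∈ Ioc (0 : ℝ) 1 :=
  Eventually.mono (show ∀ᵐ x ∂ν, x ∈ Ioo (0 : ℝ) 1 from h.compl_eq_zero)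
    fun _ hx => Ioo_subset_Ioc_self hx

variable [IsFiniteMeasure ν]

lemma mem_cells : k ∈ cells ν n ↔ k < 2 ^ n ∧ 0 < mass ν n k := by
  classical
  rw [mass, measureReal_def, ENNReal.toReal_pos_iff, and_iff_left (measure_lt_top _ _), cells,
    Finset.mem_filter, Finset.mem_range]

lemma mass_pos (hk : k ∈ cells ν n) : 0 < mass ν n k := (mem_cells.1 hk).2

namespace UnitSupported

variable (h : UnitSupported ν)
include h

lemma total_pos : 0 < ν.real univ :=
  ENNReal.toReal_pos (Measure.measure_univ_ne_zero.2 h.ne_zero) (measure_ne_top ν _)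

lemma sum_mass (n : ℕ) : ∑ k ∈ cells ν n, mass ν n k = ν.real univ := by
  have htotal : ν.real univ = ν.real (Ioc (0 : ℝ) 1) :=
    measureReal_congr (eventuallyEq_univ.2 h.ae_mem).symm
  rw [htotal, Ioc_eq_biUnion_dyadic n, measureReal_biUnion_finset
    (fun i _ j _ hij => dyadic_disjoint hij) (fun k _ => measurableSet_dyadic n k)]
  refine Finset.sum_subset (Finset.filter_subset _ _) fun k hk hk' => ?_
  by_contra hne
  exact hk' (mem_cells.2 ⟨Finset.mem_range.1 hk, lt_of_le_of_ne measureReal_nonneg (Ne.symm hne)⟩)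

lemma cells_nonempty (n : ℕ) : (cells ν n).Nonempty :=
  Finset.nonempty_of_sum_ne_zero (by rw [h.sum_mass n]; exact h.total_pos.ne')

lemma card_cells_pos (n : ℕ) : (0 : ℝ) < (cells ν n).card := by
  exact_mod_cast (h.cells_nonempty n).card_pos

lemma partitionSum_pos (n : ℕ) (q : ℝ) : 0 < partitionSum ν n q :=
  Finset.sum_pos (fun _ hk => Real.rpow_pos_of_pos (mass_pos hk) q) (h.cells_nonempty n)

lemma partitionSum_eq_rpow (hn : n ≠ 0) (q : ℝ) :
    partitionSum ν n q = ((2 : ℝ) ^ n) ^ betaN ν n q := by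
  rw [betaN_eq, Real.rpow_def_of_pos (by positivity), mul_div_cancel₀ _ (log_two_pow_pos hn).ne',
    Real.exp_log (h.partitionSum_pos n q)]

lemma betaN_one (n : ℕ) : betaN ν n 1 = massExponent ν n := by
  simp only [betaN_eq, partitionSum, Real.rpow_one, h.sum_mass, massExponent]

lemma betaN_zero_le_one (hn : n ≠ 0) : betaN ν n 0 ≤ 1 := by
  rw [betaN_eq, partitionSum_zero, div_le_one (log_two_pow_pos hn)]
  exact Real.log_le_log (h.card_cells_pos n) (by exact_mod_cast card_cells_le n)

lemma betaN_le_betaN_add (hn : n ≠ 0) (hqr : q ≤ r) :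
    betaN ν n r ≤ betaN ν n q + (r - q) * massExponent ν n := by
  have hlog_pos := log_two_pow_pos hn
  have hsum : partitionSum ν n r ≤ ν.real univ ^ (r - q) * partitionSum ν n q := by
    rw [partitionSum, partitionSum, Finset.mul_sum]
    refine Finset.sum_le_sum fun k hk => ?_
    have hm := mass_pos hk
    calc mass ν n k ^ r = mass ν n k ^ (r - q) * mass ν n k ^ q := by
          rw [← Real.rpow_add hm, sub_add_cancel]
      _ ≤ ν.real univ ^ (r - q) * mass ν n k ^ q :=
          mul_le_mul_of_nonneg_right (Real.rpow_le_rpow hm.le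
            (measureReal_mono (subset_univ _)) (sub_nonneg.2 hqr)) (Real.rpow_pos_of_pos hm q).le
  have hlog := Real.log_le_log (h.partitionSum_pos n r) hsum
  rw [Real.log_mul (Real.rpow_pos_of_pos h.total_pos _).ne' (h.partitionSum_pos n q).ne',
    Real.log_rpow h.total_pos] at hlog
  rw [betaN_eq, betaN_eq, massExponent, mul_div_assoc', ← add_div]
  gcongr
  linarith

lemma convexOn_betaN (n : ℕ) : ConvexOn ℝ univ (betaN ν n) := by
  have hlog : (0 : ℝ) ≤ (Real.log (2 ^ n))⁻¹ :=
    inv_nonneg.2 (Real.log_nonneg (one_le_pow₀ one_le_two))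
  refine ((convexOn_log_sum_rpow (h.cells_nonempty n) fun k => mass_pos).smul hlog).congr
    fun q _ => ?_
  simp only [betaN_eq, partitionSum, smul_eq_mul, div_eq_inv_mul]

lemma continuous_betaN (n : ℕ) : Continuous (betaN ν n) :=
  continuousOn_univ.1 ((h.convexOn_betaN n).continuousOn isOpen_univ)

lemma mul_massExponent_sub_le_betaN (hn : n ≠ 0) (hq : 0 ≤ q) :
    q * massExponent ν n - q ≤ betaN ν n q := by
  rcases le_or_gt q 1 with hq1 | hq1
  · have hmono := h.betaN_le_betaN_add hn hq1
    rw [h.betaN_one] at hmono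
    linarith
  · have hslope := (h.convexOn_betaN n).slope_mono_adjacent (mem_univ 0) (mem_univ q)
      zero_lt_one hq1
    rw [h.betaN_one, sub_zero, div_one, le_div_iff₀ (sub_pos.2 hq1)] at hslope
    nlinarith [h.betaN_zero_le_one hn]

lemma eventually_betaN_lt_betaN_add (C : ℝ) {ε : ℝ} (hε : 0 < ε) :
    ∀ᶠ n in atTop, ∀ ⦃q r⦄, q ≤ r → r ≤ q + C → betaN ν n r < betaN ν n q + ε := by
  have hlim : Tendsto (fun n => C * |massExponent ν n|) atTop (𝓝 0) := by
    simpa only [abs_zero, mul_zero] using (tendsto_massExponent (ν := ν)).abs.const_mul C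
  filter_upwards [hlim.eventually_lt_const hε, eventually_ne_atTop 0] with n hsmall hn q r hqr hrC
  calc betaN ν n r ≤ betaN ν n q + (r - q) * massExponent ν n := h.betaN_le_betaN_add hn hqr
    _ ≤ betaN ν n q + (r - q) * |massExponent ν n| := by
      gcongr
      exact le_abs_self _
    _ ≤ betaN ν n q + C * |massExponent ν n| := by
      gcongr
      linarith
    _ < betaN ν n q + ε := by gcongr

lemma strictAnti_betaN_sub_id (hn : n ≠ 0) (hmass : massExponent ν n < 1) :
    StrictAnti fun q => betaN ν n q - q := fun q r hqr => by
  nlinarith [h.betaN_le_betaN_add hn hqr.le]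

lemma eventually_fixedPoint : ∀ᶠ n in atTop,
    betaN ν n (fixedPoint ν n) = fixedPoint ν n ∧ fixedPoint ν n ∈ Icc (0 : ℝ) 1 := by
  filter_upwards [(tendsto_massExponent (ν := ν)).eventually_lt_const zero_lt_one,
    eventually_ne_atTop 0] with n hmass hn
  have hcont : ContinuousOn (fun q => betaN ν n q - q) (Icc 0 1) :=
    ((h.continuous_betaN n).sub continuous_id).continuousOn
  obtain ⟨q, hq, hzero⟩ := intermediate_value_Icc' zero_le_one hcont
    (show (0 : ℝ) ∈ Icc (betaN ν n 1 - 1) (betaN ν n 0 - 0) from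
      ⟨by linarith [h.betaN_one n], by linarith [betaN_zero_nonneg (ν := ν) n]⟩)
  have hset : {q : ℝ | betaN ν n q = q} = {q} := by
    ext r
    rw [mem_ofPred_eq, mem_singleton_iff, ← sub_eq_zero, ← hzero]
    exact (h.strictAnti_betaN_sub_id hn hmass).injective.eq_iff
  rw [fixedPoint, hset, csInf_singleton]
  exact ⟨sub_eq_zero.1 hzero, hq⟩

lemma isBoundedUnder_fixedPoint : IsBoundedUnder (· ≤ ·) atTop (fixedPoint ν) :=
  isBoundedUnder_of_eventually_le (h.eventually_fixedPoint.mono fun _ hn => hn.2.2)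

lemma isCoboundedUnder_fixedPoint : IsCoboundedUnder (· ≤ ·) atTop (fixedPoint ν) :=
  (isBoundedUnder_of_eventually_ge
    (h.eventually_fixedPoint.mono fun _ hn => hn.2.1)).isCoboundedUnder_le

lemma qBar_nonneg : 0 ≤ qBar ν :=
  le_limsup_of_frequently_le (h.eventually_fixedPoint.mono fun _ hn => hn.2.1).frequently
    h.isBoundedUnder_fixedPoint

lemma qBar_le_one : qBar ν ≤ 1 :=
  limsup_le_of_le h.isCoboundedUnder_fixedPoint
    (h.eventually_fixedPoint.mono fun _ hn => hn.2.2)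

end UnitSupported

/-- The `L^q`-spectrum as a real function.  It agrees with `beta ν` on `[0, ∞)`; where `beta ν` is
infinite it has the value `0`. -/
def betaReal (ν : Measure ℝ) (q : ℝ) : ℝ := (beta ν q).toReal

namespace UnitSupported

variable (h : UnitSupported ν)
include h

lemma eventually_betaN_mem_Icc (hq : 0 ≤ q) : ∀ᶠ n in atTop, betaN ν n q ∈ Icc (-q - 1) 2 := by
  have hlim : Tendsto (fun n => q * massExponent ν n) atTop (𝓝 0) := by
    simpa only [mul_zero] using (tendsto_massExponent (ν := ν)).const_mul q
  filter_upwards [hlim.eventually (Ioo_mem_nhds neg_one_lt_zero zero_lt_one),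
    eventually_ne_atTop 0] with n hsmall hn
  constructor
  · linarith [h.mul_massExponent_sub_le_betaN hn hq, hsmall.1]
  · linarith [h.betaN_le_betaN_add hn hq, h.betaN_zero_le_one hn, hsmall.2]

lemma coe_betaReal (hq : 0 ≤ q) : (betaReal ν q : EReal) = beta ν q := by
  have hev := h.eventually_betaN_mem_Icc hq
  have hle : beta ν q ≤ ((2 : ℝ) : EReal) :=
    limsup_le_of_le (by isBoundedDefault) (hev.mono fun n hn => EReal.coe_le_coe_iff.2 hn.2)
  have hge : ((-q - 1 : ℝ) : EReal) ≤ beta ν q :=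
    le_limsup_of_frequently_le
      (hev.mono fun n hn => EReal.coe_le_coe_iff.2 hn.1).frequently (by isBoundedDefault)
  exact EReal.coe_toReal (ne_top_of_le_ne_top (EReal.coe_ne_top _) hle)
    (ne_bot_of_le_ne_bot (EReal.coe_ne_bot _) hge)

lemma eventually_betaN_lt (hq : 0 ≤ q) (hr : betaReal ν q < r) :
    ∀ᶠ n in atTop, betaN ν n q < r := by
  rw [← EReal.coe_lt_coe_iff, h.coe_betaReal hq] at hr
  exact (eventually_lt_of_limsup_lt hr).mono fun n => EReal.coe_lt_coe_iff.1

lemma frequently_lt_betaN (hq : 0 ≤ q) (hr : r < betaReal ν q) :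
    ∃ᶠ n in atTop, r < betaN ν n q := by
  rw [← EReal.coe_lt_coe_iff, h.coe_betaReal hq] at hr
  exact (frequently_lt_of_lt_limsup (by isBoundedDefault) hr).mono fun n => EReal.coe_lt_coe_iff.1

lemma eventually_lt_betaN (hq : 0 ≤ q) (heq : beta ν q = betaLower ν q) (hr : r < betaReal ν q) :
    ∀ᶠ n in atTop, r < betaN ν n q := by
  rw [← EReal.coe_lt_coe_iff, h.coe_betaReal hq, heq] at hr
  exact (eventually_lt_of_lt_liminf hr).mono fun n => EReal.coe_lt_coe_iff.1

lemma betaReal_le (hq : 0 ≤ q) (hr : ∀ᶠ n in atTop, betaN ν n q ≤ r) : betaReal ν q ≤ r := by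
  by_contra! hlt
  obtain ⟨n, hn, hn'⟩ := ((h.frequently_lt_betaN hq hlt).and_eventually hr).exists
  exact hn.not_ge hn'

lemma le_betaReal (hq : 0 ≤ q) (hr : ∃ᶠ n in atTop, r ≤ betaN ν n q) : r ≤ betaReal ν q := by
  by_contra! hlt
  obtain ⟨n, hn, hn'⟩ := (hr.and_eventually (h.eventually_betaN_lt hq hlt)).exists
  exact hn.not_gt hn'

lemma betaReal_one : betaReal ν 1 = 0 := by
  have hlim : Tendsto (fun n => (betaN ν n 1 : EReal)) atTop (𝓝 ((0 : ℝ) : EReal)) := by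
    simp_rw [h.betaN_one]
    exact (continuous_coe_real_ereal.tendsto 0).comp tendsto_massExponent
  rw [betaReal, beta, hlim.limsup_eq, EReal.toReal_coe]

lemma antitoneOn_betaReal : AntitoneOn (betaReal ν) (Ici 0) := by
  intro q hq r hr hqr
  refine le_of_forall_pos_le_add fun ε hε => h.betaReal_le hr ?_
  filter_upwards [h.eventually_betaN_lt_betaN_add (r - q) (half_pos hε),
    h.eventually_betaN_lt hq (lt_add_of_pos_right _ (half_pos hε))] with n hmono hlt
  linarith [hmono hqr (by linarith)]

lemma convexOn_betaReal : ConvexOn ℝ (Ici 0) (betaReal ν) := by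
  refine ⟨convex_Ici 0, fun q hq r hr a b ha hb hab => ?_⟩
  refine le_of_forall_pos_le_add fun ε hε =>
    h.betaReal_le (convex_Ici (0 : ℝ) hq hr ha hb hab) ?_
  filter_upwards [h.eventually_betaN_lt hq (lt_add_of_pos_right _ hε),
    h.eventually_betaN_lt hr (lt_add_of_pos_right _ hε)] with n hq_lt hr_lt
  calc betaN ν n (a • q + b • r) ≤ a * betaN ν n q + b * betaN ν n r :=
        (h.convexOn_betaN n).2 (mem_univ q) (mem_univ r) ha hb hab
    _ ≤ a * (betaReal ν q + ε) + b * (betaReal ν r + ε) := by gcongr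
    _ = a • betaReal ν q + b • betaReal ν r + ε := by
      rw [smul_eq_mul, smul_eq_mul]
      linear_combination ε * hab

lemma betaReal_nonneg (hq : q ∈ Icc (0 : ℝ) 1) : 0 ≤ betaReal ν q := by
  rw [← h.betaReal_one]
  exact h.antitoneOn_betaReal hq.1 (mem_Ici.2 zero_le_one) hq.2

lemma continuousAt_betaReal (hq : 0 < q) : ContinuousAt (betaReal ν) q :=
  ((h.convexOn_betaReal.subset Ioi_subset_Ici_self (convex_Ioi 0)).continuousOn
    isOpen_Ioi).continuousAt (Ioi_mem_nhds hq)

lemma betaReal_le_qBar (hq : qBar ν < q) : betaReal ν q ≤ qBar ν := by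
  have hq0 : 0 ≤ q := h.qBar_nonneg.trans hq.le
  refine le_of_forall_pos_le_add fun ε hε => h.betaReal_le hq0 ?_
  have hlt : ∀ᶠ n in atTop, fixedPoint ν n < min q (qBar ν + ε / 2) :=
    eventually_lt_of_limsup_lt (lt_min hq (lt_add_of_pos_right _ (half_pos hε)))
      h.isBoundedUnder_fixedPoint
  filter_upwards [hlt, h.eventually_fixedPoint,
    h.eventually_betaN_lt_betaN_add q (half_pos hε)] with n hlt ⟨hfix, hmem⟩ hmono
  obtain ⟨hlt_q, hlt_add⟩ := lt_min_iff.1 hlt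
  linarith [hmono hlt_q.le (by linarith [hmem.1])]

lemma qBar_le_betaReal (hq0 : 0 ≤ q) (hq : q < qBar ν) : qBar ν ≤ betaReal ν q := by
  refine le_of_forall_pos_sub_le fun ε hε => h.le_betaReal hq0 ?_
  have hlt : ∃ᶠ n in atTop, max q (qBar ν - ε / 2) < fixedPoint ν n :=
    frequently_lt_of_lt_limsup h.isCoboundedUnder_fixedPoint
      (max_lt hq (sub_lt_self _ (half_pos hε)))
  refine (hlt.and_eventually (h.eventually_fixedPoint.and
    (h.eventually_betaN_lt_betaN_add 1 (half_pos hε)))).mono ?_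
  rintro n ⟨hlt, ⟨hfix, hmem⟩, hmono⟩
  obtain ⟨hlt_q, hlt_sub⟩ := max_lt_iff.1 hlt
  linarith [hmono hlt_q.le (by linarith [hmem.2])]

lemma betaReal_qBar (hpos : 0 < qBar ν) : betaReal ν (qBar ν) = qBar ν := by
  have hcont := (h.continuousAt_betaReal hpos).tendsto
  apply le_antisymm
  · refine le_of_tendsto (hcont.mono_left (nhdsWithin_le_nhds (s := Ioi (qBar ν)))) ?_
    filter_upwards [self_mem_nhdsWithin] with q hq using h.betaReal_le_qBar hq
  · refine ge_of_tendsto (hcont.mono_left (nhdsWithin_le_nhds (s := Iio (qBar ν)))) ?_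
    filter_upwards [Ioo_mem_nhdsLT hpos] with q hq using h.qBar_le_betaReal hq.1.le hq.2

end UnitSupported

end Partition

/-! ### The spectral dimension -/

section Growth

variable {N : ℝ → ℕ} {C q r : ℝ}

lemma eventually_log_div_log_lt (hq : 0 ≤ q) (hqr : q < r)
    (hN : ∀ᶠ x : ℝ in atTop, (N x : ℝ) ≤ C * x ^ q) :
    ∀ᶠ x : ℝ in atTop, Real.log (N x) / Real.log x < r := by
  have hconst := (Real.tendsto_log_atTop.const_div_atTop (Real.log C)).eventually_lt_const
    (sub_pos.2 hqr)
  filter_upwards [hN, hconst, eventually_gt_atTop 1] with x hNx hconst hx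
  have hlog_pos : 0 < Real.log x := Real.log_pos hx
  rcases (N x).eq_zero_or_pos with hzero | hpos
  · rw [hzero, Nat.cast_zero, Real.log_zero, zero_div]
    exact hq.trans_lt hqr
  · have hxq : 0 < x ^ q := Real.rpow_pos_of_pos (zero_lt_one.trans hx) q
    have hNpos : (0 : ℝ) < N x := by exact_mod_cast hpos
    have hC : 0 < C := pos_of_mul_pos_left (hNpos.trans_le hNx) hxq.le
    have hlog := Real.log_le_log hNpos hNx
    rw [Real.log_mul hC.ne' hxq.ne', Real.log_rpow (zero_lt_one.trans hx)] at hlog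
    rw [div_lt_iff₀ hlog_pos] at hconst ⊢
    linarith

lemma eventually_lt_log_div_log (hC : 0 < C) (hrq : r < q)
    (hN : ∀ᶠ x : ℝ in atTop, C * x ^ q ≤ N x) :
    ∀ᶠ x : ℝ in atTop, r < Real.log (N x) / Real.log x := by
  have hconst := (Real.tendsto_log_atTop.const_div_atTop (Real.log C)).eventually_const_lt
    (sub_neg.2 hrq)
  filter_upwards [hN, hconst, eventually_gt_atTop 1] with x hNx hconst hx
  have hxq : 0 < x ^ q := Real.rpow_pos_of_pos (zero_lt_one.trans hx) q
  have hlog := Real.log_le_log (mul_pos hC hxq) hNx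
  rw [Real.log_mul hC.ne' hxq.ne', Real.log_rpow (zero_lt_one.trans hx)] at hlog
  rw [lt_div_iff₀ (Real.log_pos hx)] at hconst ⊢
  linarith

lemma eventually_exists_pow_near {P : ℕ → Prop} (hP : ∀ᶠ n in atTop, P n) {c : ℝ} (hc : 1 < c) :
    ∀ᶠ x in atTop, ∃ n, P n ∧ c ^ n ≤ x ∧ x < c ^ (n + 1) := by
  obtain ⟨m, hm⟩ := eventually_atTop.1 hP
  filter_upwards [eventually_ge_atTop (c ^ m), eventually_ge_atTop 1] with x hxm hx
  obtain ⟨n, hle, hlt⟩ := exists_nat_pow_near hx hc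
  exact ⟨n, hm n (Nat.lt_succ_iff.1 ((pow_lt_pow_iff_right₀ hc).1 (hxm.trans_lt hlt))), hle, hlt⟩

lemma tendsto_two_pow_rpow {t : ℝ} (ht : 0 < t) :
    Tendsto (fun n : ℕ => ((2 : ℝ) ^ n) ^ t) atTop atTop :=
  (tendsto_rpow_atTop ht).comp (tendsto_pow_atTop_atTop_of_one_lt one_lt_two)

end Growth

lemma sum_filter_rpow_le {ι : Type*} {s : Finset ι} {a : ι → ℝ} (ha : ∀ i ∈ s, 0 < a i)
    (p : ι → Prop) [DecidablePred p] {u e : ℝ} (hu : 0 ≤ u)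
    (hp : ∀ i ∈ s, p i → a i ^ e ≤ u ^ e) (q : ℝ) :
    ∑ i ∈ s.filter p, a i ^ q ≤ u ^ e * ∑ i ∈ s, a i ^ (q - e) := by
  calc ∑ i ∈ s.filter p, a i ^ q ≤ ∑ i ∈ s.filter p, u ^ e * a i ^ (q - e) := by
        refine Finset.sum_le_sum fun i hi => ?_
        obtain ⟨his, hpi⟩ := Finset.mem_filter.1 hi
        calc a i ^ q = a i ^ e * a i ^ (q - e) := by
              rw [← Real.rpow_add (ha i his), add_sub_cancel]
          _ ≤ u ^ e * a i ^ (q - e) :=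
            mul_le_mul_of_nonneg_right (hp i his hpi) (Real.rpow_pos_of_pos (ha i his) _).le
    _ ≤ ∑ i ∈ s, u ^ e * a i ^ (q - e) :=
        Finset.sum_le_sum_of_subset_of_nonneg (Finset.filter_subset _ _) fun i hi _ =>
          mul_nonneg (Real.rpow_nonneg hu e) (Real.rpow_pos_of_pos (ha i hi) _).le
    _ = u ^ e * ∑ i ∈ s, a i ^ (q - e) := (Finset.mul_sum _ _ _).symm

lemma exists_le_add_mul_of_hasDerivAt {f : ℝ → ℝ} {f' x : ℝ} (hf : HasDerivAt f f' x)
    {ε δ : ℝ} (hε : 0 < ε) (hδ : 0 < δ) :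
    ∃ e ∈ Ioo 0 δ, f (x - e) ≤ f x + (-f' + ε) * e ∧ f (x + e) ≤ f x + (f' + ε) * e := by
  have hadd : ∀ᶠ e in 𝓝 0, f (x + e) ≤ f x + e * f' + ε * |e| := by
    filter_upwards [(hasDerivAt_iff_isLittleO_nhds_zero.1 hf).def hε] with e he
    rw [Real.norm_eq_abs, Real.norm_eq_abs, smul_eq_mul] at he
    linarith [le_abs_self (f (x + e) - f x - e * f')]
  have hneg : Tendsto Neg.neg (𝓝 (0 : ℝ)) (𝓝 0) := by
    simpa only [neg_zero] using (continuous_neg (G := ℝ)).tendsto 0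
  have hboth := (hadd.and (hneg.eventually hadd)).filter_mono (nhdsWithin_le_nhds (s := Ioi 0))
  obtain ⟨e, ⟨hadd, hsub⟩, he⟩ := (hboth.and (Ioo_mem_nhdsGT hδ)).exists
  rw [abs_neg] at hsub
  rw [abs_of_pos he.1] at hadd hsub
  exact ⟨e, he, by rw [sub_eq_add_neg]; linarith, by linarith⟩

lemma exists_differentiableAt_of_antitoneOn {f : ℝ → ℝ} {u v : ℝ} (hf : AntitoneOn f (Ioo u v))
    (huv : u < v) : ∃ q ∈ Ioo u v, DifferentiableAt ℝ f q := by
  by_contra! hno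
  have hnull : volume (Ioo u v) = 0 := by
    have hmono : MonotoneOn (fun q => -f q) (Ioo u v) := hf.neg
    refine measure_mono_null (fun q hq => ?_) (ae_iff.1 hmono.ae_differentiableWithinAt_of_mem)
    exact fun hdiff => hno q hq (differentiableAt_fun_neg_iff.1
      ((hdiff hq).differentiableAt (Ioo_mem_nhds hq.1 hq.2)))
  rw [Real.volume_Ioo, ENNReal.ofReal_eq_zero] at hnull
  linarith

section SpectralDimension

variable {ν : Measure ℝ} [IsFiniteMeasure ν] {n : ℕ} {q r a δ : ℝ}

lemma UnitSupported.summable_partitionSum (h : UnitSupported ν) (hq : qBar ν < q) :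
    Summable fun n : ℕ => partitionSum ν n q * ((2 : ℝ) ^ n) ^ (-q) := by
  obtain ⟨r, hr, hrq⟩ := exists_between hq
  have hgeo : Summable fun n : ℕ => ((2 : ℝ) ^ (r - q)) ^ n :=
    summable_geometric_of_lt_one (by positivity)
      (Real.rpow_lt_one_of_one_lt_of_neg one_lt_two (sub_neg.2 hrq))
  refine hgeo.of_norm_bounded_eventually_nat ?_
  filter_upwards [h.eventually_betaN_lt (h.qBar_nonneg.trans hq.le)
    ((h.betaReal_le_qBar hq).trans_lt hr), eventually_ne_atTop 0] with n hlt hn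
  have hpos := h.partitionSum_pos n q
  rw [Real.norm_of_nonneg (by positivity), h.partitionSum_eq_rpow hn,
    ← Real.rpow_add (by positivity), Real.rpow_pow_comm zero_le_two]
  exact Real.rpow_le_rpow_of_exponent_le (one_le_pow₀ one_le_two) (by linarith)

lemma UnitSupported.ncard_heavyCells_le (h : UnitSupported ν) (hq : qBar ν < q) {t : ℝ}
    (ht : 0 < t) : ((heavyCells ν t).ncard : ℝ) * t ^ q ≤
      ∑' n : ℕ, partitionSum ν n q * ((2 : ℝ) ^ n) ^ (-q) := by
  classical
  obtain ⟨N, hN⟩ := exists_forall_measure_dyadic_div_lt (ν := ν) ht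
  have hfin := finite_heavyCells (ν := ν) ht
  have hmem (p : ℕ × ℕ) : p ∈ hfin.toFinset ↔
      p.1 ∈ Finset.range N ∧ p.2 ∈ (cells ν p.1).filter fun k => t ≤ mass ν p.1 k / 2 ^ p.1 := by
    rw [hfin.mem_toFinset, Finset.mem_range, Finset.mem_filter, mem_cells]
    refine ⟨fun ⟨hlt, hle⟩ => ⟨?_, ⟨hlt, ?_⟩, hle⟩, fun ⟨_, ⟨hlt, _⟩, hle⟩ => ⟨hlt, hle⟩⟩
    · exact not_le.1 fun hge => (hN _ hge _).not_ge hle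
    · exact (div_pos_iff_of_pos_right (by positivity)).1 (ht.trans_le hle)
  calc ((heavyCells ν t).ncard : ℝ) * t ^ q = ∑ _p ∈ hfin.toFinset, t ^ q := by
        rw [Finset.sum_const, nsmul_eq_mul, Set.ncard_eq_toFinset_card _ hfin]
    _ ≤ ∑ p ∈ hfin.toFinset, (mass ν p.1 p.2 / 2 ^ p.1) ^ q :=
        Finset.sum_le_sum fun p hp => Real.rpow_le_rpow ht.le (hfin.mem_toFinset.1 hp).2
          (h.qBar_nonneg.trans hq.le)
    _ = ∑ n ∈ Finset.range N, ∑ k ∈ (cells ν n).filter fun k => t ≤ mass ν n k / 2 ^ n,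
          (mass ν n k / 2 ^ n) ^ q :=
        Finset.sum_finset_product' _ _ _ hmem (f := fun n k => (mass ν n k / 2 ^ n) ^ q)
    _ ≤ ∑ n ∈ Finset.range N, partitionSum ν n q * ((2 : ℝ) ^ n) ^ (-q) := by
        refine Finset.sum_le_sum fun n _ => (Finset.sum_le_sum_of_subset_of_nonneg
          (Finset.filter_subset _ _) fun k _ _ => by positivity).trans_eq ?_
        rw [partitionSum, Finset.sum_mul]
        refine Finset.sum_congr rfl fun k _ => ?_
        rw [Real.div_rpow measureReal_nonneg (by positivity), Real.rpow_neg (by positivity),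
          div_eq_mul_inv]
    _ ≤ ∑' n : ℕ, partitionSum ν n q * ((2 : ℝ) ^ n) ^ (-q) :=
        (h.summable_partitionSum hq).sum_le_tsum _ fun n _ =>
          mul_nonneg (h.partitionSum_pos n q).le (by positivity)

lemma UnitSupported.eventually_log_eigenvalueCount_div_log_lt (h : UnitSupported ν)
    (hr : qBar ν < r) : ∀ᶠ x : ℝ in atTop, Real.log (eigenvalueCount ν x) / Real.log x < r := by
  obtain ⟨q, hq, hqr⟩ := exists_between hr
  set S := ∑' n : ℕ, partitionSum ν n q * ((2 : ℝ) ^ n) ^ (-q)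
  refine eventually_log_div_log_lt (C := S * 2 ^ q) (h.qBar_nonneg.trans hq.le) hqr ?_
  filter_upwards [eventually_gt_atTop 0] with x hx
  have ht : 0 < (2 * x)⁻¹ := by positivity
  have hcount : (eigenvalueCount ν x : ℝ) ≤ (heavyCells ν (2 * x)⁻¹).ncard := by
    exact_mod_cast eigenvalueCount_le_ncard_heavyCells h.compl_eq_zero ht hx
      (by field_simp; norm_num)
  have hheavy := h.ncard_heavyCells_le hq ht
  rw [Real.inv_rpow (by positivity), ← div_eq_mul_inv, div_le_iff₀ (by positivity),
    Real.mul_rpow zero_le_two hx.le, ← mul_assoc] at hheavy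
  exact hcount.trans hheavy

open Classical in
/-- The cells `C` of order `n` with local exponent `-log ν(C) / log 2ⁿ` in `[a - δ, a + δ]`. -/
def typicalCells (ν : Measure ℝ) (n : ℕ) (a δ : ℝ) : Finset ℕ :=
  (cells ν n).filter fun k =>
    ((2 : ℝ) ^ n) ^ (-(a + δ)) ≤ mass ν n k ∧ mass ν n k ≤ ((2 : ℝ) ^ n) ^ (-(a - δ))

omit [IsFiniteMeasure ν] in
lemma typicalCells_subset_cells : typicalCells ν n a δ ⊆ cells ν n := by
  classical exact Finset.filter_subset _ _

lemma partitionSum_le_add_sum_typicalCells {e : ℝ} (he : 0 ≤ e) :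
    partitionSum ν n q ≤ ((2 : ℝ) ^ n) ^ (-(a + δ) * e) * partitionSum ν n (q - e) +
      ((2 : ℝ) ^ n) ^ ((a - δ) * e) * partitionSum ν n (q + e) +
      ∑ k ∈ typicalCells ν n a δ, mass ν n k ^ q := by
  classical
  set X : ℝ := (2 : ℝ) ^ n
  have hX : 0 < X := by positivity
  have hlight := sum_filter_rpow_le (s := cells ν n) (fun k => mass_pos)
    (fun k => mass ν n k < X ^ (-(a + δ))) (Real.rpow_nonneg hX.le _)
    (fun k hk hlt => Real.rpow_le_rpow (mass_pos hk).le hlt.le he) q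
  have hheavy := sum_filter_rpow_le (s := cells ν n) (fun k => mass_pos)
    (fun k => X ^ (-(a - δ)) < mass ν n k) (Real.rpow_nonneg hX.le _)
    (fun k _ hlt => Real.rpow_le_rpow_of_nonpos (Real.rpow_pos_of_pos hX _) hlt.le
      (neg_nonpos.2 he)) q
  rw [← Real.rpow_mul hX.le] at hlight hheavy
  rw [neg_mul_neg, sub_neg_eq_add] at hheavy
  refine le_trans ?_ (add_le_add_left (add_le_add hlight hheavy) _)
  rw [partitionSum, typicalCells, Finset.sum_filter, Finset.sum_filter, Finset.sum_filter,
    ← Finset.sum_add_distrib, ← Finset.sum_add_distrib]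
  refine Finset.sum_le_sum fun k hk => ?_
  have hpos := Real.rpow_pos_of_pos (mass_pos hk) q
  split_ifs with hl hh ht ht hh ht ht <;> grind

namespace UnitSupported

variable (h : UnitSupported ν)
include h

lemma eventually_le_sum_typicalCells (hq : 0 < q) (hd : HasDerivAt (betaReal ν) (-a) q)
    (heq : beta ν q = betaLower ν q) (hδ : 0 < δ) : ∀ᶠ n in atTop,
      ((2 : ℝ) ^ n) ^ (betaReal ν q - δ) / 2 ≤ ∑ k ∈ typicalCells ν n a δ, mass ν n k ^ q := by
  set b := betaReal ν q
  obtain ⟨e, he, hleft, hright⟩ :=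
    exists_le_add_mul_of_hasDerivAt hd (show 0 < δ / 4 by linarith) (lt_min hq zero_lt_one)
  obtain ⟨heq_lt, he_lt⟩ := lt_min_iff.1 he.2
  have hδe : 0 < δ * e := mul_pos hδ he.1
  filter_upwards [h.eventually_lt_betaN hq.le heq (show b - δ * e / 4 < b by linarith),
    h.eventually_betaN_lt (sub_nonneg.2 heq_lt.le)
      (show betaReal ν (q - e) < b + (a + δ / 2) * e by linarith),
    h.eventually_betaN_lt (add_nonneg hq.le he.1.le)
      (show betaReal ν (q + e) < b + (-a + δ / 2) * e by linarith),
    (tendsto_two_pow_rpow (show 0 < δ * e / 4 by linarith)).eventually_ge_atTop 4,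
    eventually_ne_atTop 0] with n hlow hleft hright hlarge hn
  have hsplit := partitionSum_le_add_sum_typicalCells (ν := ν) (n := n) (q := q) (a := a) (δ := δ)
    he.1.le
  simp only [h.partitionSum_eq_rpow hn] at hsplit
  set X : ℝ := (2 : ℝ) ^ n
  have hX : 0 < X := by positivity
  have hX1 : 1 ≤ X := one_le_pow₀ one_le_two
  rw [← Real.rpow_add hX, ← Real.rpow_add hX] at hsplit
  have hlight : X ^ (-(a + δ) * e + betaN ν n (q - e)) ≤ X ^ (b - δ * e / 2) :=
    Real.rpow_le_rpow_of_exponent_le hX1 (by linarith)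
  have hheavy : X ^ ((a - δ) * e + betaN ν n (q + e)) ≤ X ^ (b - δ * e / 2) :=
    Real.rpow_le_rpow_of_exponent_le hX1 (by linarith)
  have htotal : X ^ (b - δ * e / 4) ≤ X ^ betaN ν n q :=
    Real.rpow_le_rpow_of_exponent_le hX1 hlow.le
  have htails : 4 * X ^ (b - δ * e / 2) ≤ X ^ (b - δ * e / 4) := by
    calc 4 * X ^ (b - δ * e / 2) ≤ X ^ (δ * e / 4) * X ^ (b - δ * e / 2) := by gcongr
      _ = X ^ (b - δ * e / 4) := by rw [← Real.rpow_add hX]; congr 1; ring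
  have hexp : X ^ (b - δ) ≤ X ^ (b - δ * e / 4) :=
    Real.rpow_le_rpow_of_exponent_le hX1 (by nlinarith)
  linarith

omit [IsFiniteMeasure ν] h in
lemma sum_typicalCells_le (hq : 0 ≤ q) : ∑ k ∈ typicalCells ν n a δ, mass ν n k ^ q ≤
    (typicalCells ν n a δ).card * ((2 : ℝ) ^ n) ^ (-(a - δ) * q) := by
  classical
  rw [← nsmul_eq_mul]
  refine Finset.sum_le_card_nsmul _ _ _ fun k hk => ?_
  rw [Real.rpow_mul (by positivity)]
  exact Real.rpow_le_rpow measureReal_nonneg (Finset.mem_filter.1 hk).2.2 hq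

lemma eventually_le_card_typicalCells (hq : 0 < q) (hd : HasDerivAt (betaReal ν) (-a) q)
    (heq : beta ν q = betaLower ν q) (hδ : 0 < δ) : ∀ᶠ n in atTop,
      ((2 : ℝ) ^ n) ^ (betaReal ν q - δ + (a - δ) * q) / 2 ≤ (typicalCells ν n a δ).card := by
  filter_upwards [h.eventually_le_sum_typicalCells hq hd heq hδ] with n hsum
  have hX : (0 : ℝ) < 2 ^ n := by positivity
  have hle := hsum.trans (sum_typicalCells_le hq.le)
  rw [neg_mul, Real.rpow_neg hX.le, ← div_eq_mul_inv,
    le_div_iff₀ (Real.rpow_pos_of_pos hX _)] at hle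
  rwa [Real.rpow_add hX, ← div_mul_eq_mul_div]

lemma card_typicalCells_le {x : ℝ} (hx : 2 * ((2 : ℝ) ^ n) ^ (1 + a + δ) < x) :
    (typicalCells ν n a δ).card ≤ 3 * eigenvalueCount ν x + 2 := by
  classical
  have hX : (0 : ℝ) < 2 ^ n := by positivity
  obtain ⟨K, hK, hsep, hcard⟩ := exists_separatedCells
    fun k (hk : k ∈ typicalCells ν n a δ) => lt_of_mem_cells (typicalCells_subset_cells hk)
  refine hcard.trans (Nat.add_le_add_right (Nat.mul_le_mul_left 3 ?_) 2)
  refine card_le_eigenvalueCount h.compl_eq_zero hsep (m := ((2 : ℝ) ^ n) ^ (-(a + δ)))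
    (fun k hk => (Finset.mem_filter.1 (hK hk)).2.1) (lt_trans (by positivity) hx) ?_
  have hscale : ((2 : ℝ) ^ n) ^ (-(a + δ)) * (2 * ((2 : ℝ) ^ n) ^ (1 + a + δ)) = 2 * 2 ^ n := by
    rw [mul_left_comm, ← Real.rpow_add hX]
    ring_nf
    rw [Real.rpow_one]
  rw [← hscale]
  gcongr

lemma deriv_betaReal_nonpos (hq : 0 < q) : deriv (betaReal ν) q ≤ 0 := by
  rw [← derivWithin_of_mem_nhds (Ici_mem_nhds hq)]
  exact h.antitoneOn_betaReal.derivWithin_nonpos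

lemma eventually_lt_log_eigenvalueCount_div_log (hq : 0 < q) (hqb : q ≤ betaReal ν q)
    (heq : beta ν q = betaLower ν q) (hd : DifferentiableAt ℝ (betaReal ν) q) (hr : r < q) :
    ∀ᶠ x : ℝ in atTop, r < Real.log (eigenvalueCount ν x) / Real.log x := by
  obtain ⟨s, hrs, hsq⟩ := exists_between (max_lt hr hq)
  obtain ⟨hrs, hs⟩ := max_lt_iff.1 hrs
  set a := -deriv (betaReal ν) q
  have ha : 0 ≤ a := neg_nonneg.2 (h.deriv_betaReal_nonpos hq)
  have hderiv : HasDerivAt (betaReal ν) (-a) q := by rw [neg_neg]; exact hd.hasDerivAt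
  set δ := (q - s) / (1 + 2 * q) with hδ_def
  have hδ : 0 < δ := div_pos (sub_pos.2 hsq) (by positivity)
  have hδ_mul : δ * (1 + 2 * q) = q - s := by rw [hδ_def]; field_simp
  set b := 1 + a + δ
  have hb : 0 < b := by positivity
  set κ := betaReal ν q - δ + (a - δ) * q
  have hκ : b * s ≤ κ := by nlinarith [mul_nonneg (sub_pos.2 hsq).le ha]
  have hκ_pos : 0 < κ := (mul_pos hb hs).trans_le hκ
  set c : ℝ := 2 ^ b
  have hc : 1 < c := Real.one_lt_rpow one_lt_two hb
  have hscale := (tendsto_id.atTop_div_const (three_pos (α := ℝ))).eventually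
    (eventually_exists_pow_near ((h.eventually_le_card_typicalCells hq hderiv heq hδ).and
      ((tendsto_two_pow_rpow hκ_pos).eventually_ge_atTop 8)) hc)
  refine eventually_lt_log_div_log (C := ((3 * c) ^ s)⁻¹ / 12) (by positivity) hrs ?_
  filter_upwards [hscale, eventually_gt_atTop 0] with x ⟨n, ⟨hcard, hlarge⟩, hle, hlt⟩ hx
  simp only [id] at hle hlt
  have hcn : c ^ n = ((2 : ℝ) ^ n) ^ b := (Real.rpow_pow_comm zero_le_two b n)
  have hpos : 0 < c ^ n := by positivity
  have hcount : ((typicalCells ν n a δ).card : ℝ) ≤ 3 * eigenvalueCount ν x + 2 := by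
    exact_mod_cast h.card_typicalCells_le (a := a) (δ := δ) (by rw [← hcn]; linarith)
  have hxs : x ^ s ≤ (3 * c) ^ s * ((2 : ℝ) ^ n) ^ κ := by
    calc x ^ s ≤ (3 * c * c ^ n) ^ s :=
          Real.rpow_le_rpow hx.le (by rw [pow_succ] at hlt; linarith) hs.le
      _ = (3 * c) ^ s * ((2 : ℝ) ^ n) ^ (b * s) := by
          rw [Real.mul_rpow (by positivity) hpos.le, hcn, ← Real.rpow_mul (by positivity)]
      _ ≤ (3 * c) ^ s * ((2 : ℝ) ^ n) ^ κ := by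
          gcongr
          exact one_le_pow₀ one_le_two
  calc ((3 * c) ^ s)⁻¹ / 12 * x ^ s
      ≤ ((3 * c) ^ s)⁻¹ / 12 * ((3 * c) ^ s * ((2 : ℝ) ^ n) ^ κ) := by gcongr
    _ = ((2 : ℝ) ^ n) ^ κ / 12 := by field_simp
    _ ≤ eigenvalueCount ν x := by linarith

theorem hasSpectralDim_qBar (hreg : IsLqRegular ν) : HasSpectralDim ν (qBar ν) := by
  refine tendsto_order.2
    ⟨fun r hr => ?_, fun r hr => h.eventually_log_eigenvalueCount_div_log_lt hr⟩
  rcases h.qBar_nonneg.eq_or_lt with hzero | hpos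
  · filter_upwards [eventually_gt_atTop 1] with x hx
    exact (hr.trans_eq hzero.symm).trans_le
      (div_nonneg (Real.log_natCast_nonneg _) (Real.log_pos hx).le)
  rcases hreg with ⟨ε, hε, hreg⟩ | ⟨heq, hdiff⟩
  · obtain ⟨q, hq, hd⟩ := exists_differentiableAt_of_antitoneOn
      (h.antitoneOn_betaReal.mono fun q hq => (le_max_right (max r (qBar ν - ε)) 0).trans hq.1.le)
      (max_lt (max_lt hr (sub_lt_self _ hε)) hpos)
    obtain ⟨hq_gt, hq0⟩ := max_lt_iff.1 hq.1
    obtain ⟨hrq, hεq⟩ := max_lt_iff.1 hq_gt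
    exact h.eventually_lt_log_eigenvalueCount_div_log hq0
      (hq.2.le.trans (h.qBar_le_betaReal hq0.le hq.2)) (hreg q ⟨hεq, hq.2⟩) hd hrq
  · exact h.eventually_lt_log_eigenvalueCount_div_log hpos (h.betaReal_qBar hpos).ge heq
      hdiff.2 hr

end UnitSupported

end SpectralDimension

/-! ### Covering numbers and dimensions -/

lemma exists_isCover_encard_eq_externalCoveringNumber {X : Type*} [PseudoEMetricSpace X] (ε : ℝ≥0)
    (A : Set X) :
    ∃ C, Metric.IsCover ε A C ∧ C.encard = Metric.externalCoveringNumber ε A := by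
  have : Nonempty {C : Set X // Metric.IsCover ε A C} := ⟨⟨A, Metric.IsCover.rfl⟩⟩
  obtain ⟨C, hC⟩ :=
    ENat.exists_eq_iInf fun C : {C : Set X // Metric.IsCover ε A C} => (C : Set X).encard
  exact ⟨C, C.2, hC.trans (by rw [Metric.externalCoveringNumber, iInf_subtype])⟩

lemma exists_finset_isCover_card_eq_externalCoveringNumber {X : Type*} [PseudoEMetricSpace X]
    {ε : ℝ≥0} {A : Set X} (hA : Metric.externalCoveringNumber ε A ≠ ⊤) :
    ∃ C : Finset X, Metric.IsCover ε A C ∧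
      (C.card : ℕ∞) = Metric.externalCoveringNumber ε A := by
  obtain ⟨C, hC, hcard⟩ := exists_isCover_encard_eq_externalCoveringNumber ε A
  lift C to Finset X using Set.encard_ne_top_iff.1 (hcard ▸ hA)
  exact ⟨C, hC, by rw [← hcard, Set.encard_coe_eq_coe_finsetCard]⟩

lemma dimH_le_of_frequently_externalCoveringNumber_mul_rpow_le {X : Type*} [EMetricSpace X]
    {A : Set X} {d : ℝ≥0} {M : ℝ≥0∞} (hM : M ≠ ∞)
    (hA : ∃ᶠ ε : ℝ≥0 in 𝓝[>] 0,
      (Metric.externalCoveringNumber ε A : ℝ≥0∞) * (ε : ℝ≥0∞) ^ (d : ℝ) ≤ M) : dimH A ≤ d := by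
  borelize X
  obtain ⟨ε, hε, hle⟩ := exists_seq_forall_of_frequently (hA.and_eventually self_mem_nhdsWithin)
  have hfin : ∀ n, Metric.externalCoveringNumber (ε n) A ≠ ⊤ := by
    intro n htop
    have hpow : 0 < (ε n : ℝ≥0∞) ^ (d : ℝ) :=
      ENNReal.rpow_pos (ENNReal.coe_pos.2 (hle n).2) ENNReal.coe_ne_top
    have hle_n := (hle n).1
    rw [htop, ENat.toENNReal_top, ENNReal.top_mul hpow.ne', top_le_iff] at hle_n
    exact hM hle_n
  choose C hC hcard using fun n => exists_finset_isCover_card_eq_externalCoveringNumber (hfin n)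
  have hscale : Tendsto (fun n => 2 * (ε n : ℝ≥0∞)) atTop (𝓝 0) := by
    have hε0 := ENNReal.tendsto_coe.2 (hε.mono_right nhdsWithin_le_nhds)
    simpa using ENNReal.Tendsto.const_mul hε0 (Or.inr ENNReal.ofNat_ne_top)
  have hsum : ∀ n, ∑ c : C n, Metric.ediam (Metric.closedEBall (c : X) (ε n)) ^ (d : ℝ) ≤
      2 ^ (d : ℝ) * M := by
    intro n
    calc ∑ c : C n, Metric.ediam (Metric.closedEBall (c : X) (ε n)) ^ (d : ℝ)
        ≤ ∑ _c : C n, (2 * (ε n : ℝ≥0∞)) ^ (d : ℝ) := by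
          gcongr
          exact Metric.ediam_closedEBall_le
      _ = 2 ^ (d : ℝ) * (Metric.externalCoveringNumber (ε n) A * (ε n : ℝ≥0∞) ^ (d : ℝ)) := by
          rw [Finset.sum_const, nsmul_eq_mul, ENNReal.mul_rpow_of_nonneg _ _ d.coe_nonneg,
            ← hcard, Finset.card_univ, Fintype.card_coe, ENat.toENNReal_coe, mul_left_comm]
      _ ≤ 2 ^ (d : ℝ) * M := mul_le_mul_right (hle n).1 _
  have hbound : μH[(d : ℝ)] A ≤ 2 ^ (d : ℝ) * M :=
    (Measure.hausdorffMeasure_le_liminf_sum d A _ hscale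
      (fun n (c : C n) => Metric.closedEBall (c : X) (ε n))
      (.of_forall fun n c => Metric.ediam_closedEBall_le) (.of_forall fun n => by
        simpa only [iUnion_subtype, Finset.mem_coe] using
          Metric.isCover_iff_subset_iUnion_closedEBall.1 (hC n))).trans
      (liminf_le_of_frequently_le (.of_forall hsum))
  exact dimH_le_of_hausdorffMeasure_ne_top (ne_top_of_le_ne_top
    (ENNReal.mul_ne_top (ENNReal.rpow_ne_top_of_nonneg d.coe_nonneg ENNReal.ofNat_ne_top) hM)
    hbound)

/-- The ratio `log N_ε(A) / log (1/ε)` of which the upper Minkowski dimension of `A` is the upper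
limit as `ε → 0`. -/
def boxRatio (A : Set ℝ) (ε : ℝ≥0) : EReal :=
  ENNReal.log (Metric.externalCoveringNumber ε A : ℝ≥0∞) / ((-Real.log ε : ℝ) : EReal)

lemma externalCoveringNumber_mul_rpow_le_one {A : Set ℝ} {ε d : ℝ≥0} (hε : 0 < ε) (hε1 : ε < 1)
    (h : boxRatio A ε < (d : ℝ)) :
    (Metric.externalCoveringNumber ε A : ℝ≥0∞) * (ε : ℝ≥0∞) ^ (d : ℝ) ≤ 1 := by
  have hlog : 0 < -Real.log ε := neg_pos.2 (Real.log_neg hε hε1)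
  rw [boxRatio, EReal.div_lt_iff (EReal.coe_pos.2 hlog) (EReal.coe_ne_top _),
    ← EReal.coe_mul] at h
  rw [← ENNReal.log_le_zero_iff, ENNReal.log_mul_add, ENNReal.log_rpow,
    ENNReal.log_of_nnreal hε.ne']
  calc _ ≤ ((d * -Real.log ε : ℝ) : EReal) + (d : ℝ) * (Real.log ε : ℝ) := by gcongr
    _ = 0 := by rw [← EReal.coe_mul, ← EReal.coe_add, mul_neg, neg_add_cancel, EReal.coe_zero]

lemma dimH_le_upperMinkowskiDim (A : Set ℝ) : dimH A ≤ upperMinkowskiDim A := by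
  by_contra! hlt
  obtain ⟨d, hd, hdim⟩ := ENNReal.lt_iff_exists_nnreal_btwn.1 hlt
  have hlimsup : limsup (boxRatio A) (𝓝[>] 0) < (d : ℝ) := by
    calc limsup (boxRatio A) (𝓝[>] 0) ≤ (upperMinkowskiDim A : EReal) :=
          (le_max_right 0 _).trans_eq EReal.coe_toENNReal_eq_max.symm
      _ < (d : ℝ) := EReal.coe_ennreal_lt_coe_ennreal_iff.2 hd
  refine hdim.not_ge (dimH_le_of_frequently_externalCoveringNumber_mul_rpow_le ENNReal.one_ne_top
    (Eventually.frequently ?_))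
  filter_upwards [eventually_lt_of_limsup_lt hlimsup, Ioo_mem_nhdsGT (zero_lt_one (α := ℝ≥0))]
    with ε hratio hε
  exact externalCoveringNumber_mul_rpow_le_one hε.1 hε.2 hratio

section MeasureDimensions

variable {ν : Measure ℝ}

lemma measureLowerHausdorffDim_le_measureHausdorffDim (hν : ν ≠ 0) :
    measureLowerHausdorffDim ν ≤ measureHausdorffDim ν := by
  refine le_iInf₂ fun A hA => le_iInf fun hnull => iInf₂_le_of_le A hA (iInf_le _ ?_)
  rw [measure_of_measure_compl_eq_zero hnull, Measure.measure_univ_pos]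
  exact hν

lemma measureHausdorffDim_le_measurePackingDim (ν : Measure ℝ) :
    measureHausdorffDim ν ≤ measurePackingDim ν := by
  refine iInf_mono fun A => iInf₂_mono fun _ _ => le_iInf₂ fun F hF => ?_
  calc dimH A ≤ dimH (⋃ i, F i) := dimH_mono hF
    _ = ⨆ i, dimH (F i) := dimH_iUnion F
    _ ≤ ⨆ i, upperMinkowskiDim (F i) := iSup_mono fun i => dimH_le_upperMinkowskiDim (F i)

lemma measurePackingDim_le_measureMinkowskiDim (ν : Measure ℝ) :
    measurePackingDim ν ≤ measureMinkowskiDim ν :=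
  calc measurePackingDim ν ≤ packingDim ν.support :=
        iInf₂_le_of_le ν.support Measure.isClosed_support.measurableSet
          (iInf_le _ Measure.measure_compl_support)
    _ ≤ ⨆ _ : ℕ, measureMinkowskiDim ν :=
        iInf₂_le (fun _ : ℕ => ν.support) (subset_iUnion (fun _ : ℕ => ν.support) 0)
    _ = measureMinkowskiDim ν := iSup_const

/-! ### The Minkowski dimension of the support -/

lemma exists_mem_near_of_isCover {n k : ℕ} {ε : ℝ≥0} (hε : 2 ^ n * (ε : ℝ) ≤ 1) {C : Set ℝ}
    (hC : Metric.IsCover ε ν.support C) (hk : k ∈ cells ν n) :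
    ∃ c ∈ C, (2 : ℝ) ^ n * c - 2 ≤ k ∧ (k : ℝ) < 2 ^ n * c + 1 := by
  obtain ⟨x, hx, hsupp⟩ := Measure.nonempty_inter_support_of_pos (Finset.mem_filter.1 hk).2
  obtain ⟨c, hc, hxc⟩ := mem_iUnion₂.1 (Metric.isCover_iff_subset_iUnion_closedBall.1 hC hsupp)
  obtain ⟨hkx, hxk⟩ := mem_dyadic_iff.1 hx
  obtain ⟨hlo, hhi⟩ := abs_le.1 (Metric.mem_closedBall.1 hxc)
  have hscale : (0 : ℝ) < 2 ^ n := by positivity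
  exact ⟨c, hc, by nlinarith, by nlinarith⟩

lemma card_cells_le_of_isCover {n : ℕ} {ε : ℝ≥0} (hε : 2 ^ n * (ε : ℝ) ≤ 1) {C : Set ℝ}
    (hC : Metric.IsCover ε ν.support C) : ((cells ν n).card : ℕ∞) ≤ 3 * C.encard := by
  classical
  choose! f hf hle hlt using fun k (hk : k ∈ cells ν n) => exists_mem_near_of_isCover hε hC hk
  have hfiber : ∀ c ∈ (cells ν n).image f, ((cells ν n).filter (f · = c)).card ≤ 3 := by
    intro c _
    have hsub : (cells ν n).filter (f · = c) ⊆
        Finset.Ico ⌈(2 : ℝ) ^ n * c - 2⌉₊ (⌈(2 : ℝ) ^ n * c - 2⌉₊ + 3) := by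
      intro k hk
      obtain ⟨hkc, rfl⟩ := Finset.mem_filter.1 hk
      refine Finset.mem_Ico.2 ⟨Nat.ceil_le.2 (hle k hkc), ?_⟩
      have hceil := Nat.le_ceil ((2 : ℝ) ^ n * f k - 2)
      have hk_lt : (k : ℝ) < ⌈(2 : ℝ) ^ n * f k - 2⌉₊ + 3 := by linarith [hlt k hkc]
      exact_mod_cast hk_lt
    simpa only [Nat.card_Ico, add_tsub_cancel_left] using Finset.card_le_card hsub
  calc ((cells ν n).card : ℕ∞) ≤ 3 * ((cells ν n).image f).card := by
        exact_mod_cast Finset.card_le_mul_card_image _ _ hfiber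
    _ ≤ 3 * C.encard := by
        rw [← Set.encard_coe_eq_coe_finsetCard, Finset.coe_image]
        gcongr
        exact image_subset_iff.2 hf

lemma card_cells_le_three_mul_externalCoveringNumber {n : ℕ} {ε : ℝ≥0}
    (hε : 2 ^ n * (ε : ℝ) ≤ 1) :
    ((cells ν n).card : ℕ∞) ≤ 3 * Metric.externalCoveringNumber ε ν.support := by
  obtain ⟨C, hC, hcard⟩ := exists_isCover_encard_eq_externalCoveringNumber ε ν.support
  exact hcard ▸ card_cells_le_of_isCover hε hC

lemma externalCoveringNumber_biUnion_dyadic_le {n : ℕ} {ε : ℝ≥0} (hε : 1 ≤ 2 ^ n * (ε : ℝ))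
    (s : Finset ℕ) :
    Metric.externalCoveringNumber ε (closure (⋃ k ∈ s, dyadic n k)) ≤ s.card := by
  classical
  set C := s.image fun k : ℕ => ((k : ℝ) + 1) / 2 ^ n
  have hcover : Metric.IsCover ε (closure (⋃ k ∈ s, dyadic n k)) (C : Set ℝ) := by
    rw [Metric.isCover_closure C.finite_toSet.isClosed, Metric.isCover_iff_subset_iUnion_closedBall]
    refine iUnion₂_subset fun k hk x hx =>
      mem_iUnion₂.2 ⟨_, Finset.mem_coe.2 (Finset.mem_image_of_mem _ hk), ?_⟩
    have hε' : 1 / 2 ^ n ≤ (ε : ℝ) := by rwa [div_le_iff₀' (by positivity)]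
    rw [Real.closedBall_eq_Icc, add_div]
    rw [dyadic, add_div] at hx
    exact ⟨by linarith [hx.1], by linarith [hx.2, ε.coe_nonneg]⟩
  refine hcover.externalCoveringNumber_le_encard.trans ?_
  rw [Set.encard_coe_eq_coe_finsetCard]
  exact_mod_cast Finset.card_image_le

end MeasureDimensions

namespace UnitSupported

variable {ν : Measure ℝ} [IsFiniteMeasure ν] (h : UnitSupported ν)
include h

lemma ae_exists_mem_cells (n : ℕ) : ∀ᵐ x ∂ν, ∃ k ∈ cells ν n, x ∈ dyadic n k := by
  have hnull : ∀ᵐ x ∂ν, ∀ k ∈ Finset.range (2 ^ n) \ cells ν n, x ∉ dyadic n k := by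
    rw [Finset.eventually_all]
    intro k hk
    obtain ⟨hlt, hnot⟩ := Finset.mem_sdiff.1 hk
    refine measure_eq_zero_iff_ae_notMem.1 (not_not.1 fun hne => hnot (mem_cells.2 ?_))
    exact ⟨Finset.mem_range.1 hlt, ENNReal.toReal_pos hne (measure_ne_top ν _)⟩
  filter_upwards [h.ae_mem, hnull] with x hx hx_null
  obtain ⟨k, hk, hxk⟩ := exists_mem_dyadic n hx
  refine ⟨k, not_not.1 fun hnot => ?_, hxk⟩
  exact hx_null k (Finset.mem_sdiff.2 ⟨Finset.mem_range.2 hk, hnot⟩) hxk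

lemma externalCoveringNumber_le {n : ℕ} {ε : ℝ≥0} (hε : 1 ≤ 2 ^ n * (ε : ℝ)) :
    Metric.externalCoveringNumber ε ν.support ≤ (cells ν n).card := by
  have hsub : ν.support ⊆ closure (⋃ k ∈ cells ν n, dyadic n k) := by
    refine Measure.support_subset_of_isClosed isClosed_closure ?_
    filter_upwards [h.ae_exists_mem_cells n] with x ⟨k, hk, hx⟩
    exact subset_closure (mem_iUnion₂.2 ⟨k, hk, hx⟩)
  exact (Metric.externalCoveringNumber_mono_set hsub).trans
    (externalCoveringNumber_biUnion_dyadic_le hε _)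

lemma boxRatio_support_le {n : ℕ} {ε : ℝ≥0} (hε1 : ε < 1) (hε : 1 ≤ 2 ^ n * (ε : ℝ)) :
    boxRatio ν.support ε ≤ ((Real.log (cells ν n).card / -Real.log ε : ℝ) : EReal) := by
  have hcard : (0 : ℝ) < (cells ν n).card := h.card_cells_pos n
  rw [EReal.coe_div, ← ENNReal.log_ofReal_of_pos hcard, ENNReal.ofReal_natCast]
  refine EReal.div_le_div_right_of_nonneg
    (EReal.coe_nonneg.2 (neg_nonneg.2 (Real.log_nonpos ε.2 hε1.le))) (ENNReal.log_le_log ?_)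
  exact_mod_cast h.externalCoveringNumber_le hε

lemma le_boxRatio_support {n : ℕ} {ε : ℝ≥0} (hε1 : ε < 1) (hε : 2 ^ n * (ε : ℝ) ≤ 1) :
    ((Real.log ((cells ν n).card / 3) / -Real.log ε : ℝ) : EReal) ≤ boxRatio ν.support ε := by
  have hcard : (0 : ℝ) < (cells ν n).card := h.card_cells_pos n
  rw [EReal.coe_div, ← ENNReal.log_ofReal_of_pos (by positivity)]
  refine EReal.div_le_div_right_of_nonneg
    (EReal.coe_nonneg.2 (neg_nonneg.2 (Real.log_nonpos ε.2 hε1.le))) (ENNReal.log_le_log ?_)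
  rw [ENNReal.ofReal_div_of_pos three_pos, ENNReal.ofReal_natCast, ENNReal.ofReal_ofNat]
  refine ENNReal.div_le_of_le_mul' ?_
  simpa using ENat.toENNReal_le.2 (card_cells_le_three_mul_externalCoveringNumber (ν := ν) hε)

lemma limsup_boxRatio_support_le : limsup (boxRatio ν.support) (𝓝[>] 0) ≤ deltaStar ν := by
  refine EReal.le_of_forall_lt_iff_le.1 fun r hr => limsup_le_of_le (by isBoundedDefault) ?_
  obtain ⟨s, hδs, hsr⟩ := exists_between (EReal.coe_lt_coe_iff.1 hr)
  have hs : 0 ≤ s := (h.betaReal_nonneg ⟨le_rfl, zero_le_one⟩).trans hδs.le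
  have hinv : Tendsto (fun ε : ℝ≥0 => (ε : ℝ)⁻¹) (𝓝[>] 0) atTop :=
    NNReal.tendsto_coe_atTop.2 tendsto_inv_nhdsGT_zero
  have hscale := eventually_exists_pow_near
    ((tendsto_add_atTop_nat 1).eventually (h.eventually_betaN_lt le_rfl hδs)) one_lt_two
  have hlog := (Real.tendsto_log_atTop.comp hinv).eventually_ge_atTop (s * Real.log 2 / (r - s))
  filter_upwards [hinv.eventually hscale, hlog, Ioo_mem_nhdsGT (zero_lt_one (α := ℝ≥0))]
    with ε ⟨n, hβ, hle, hlt⟩ hlarge hε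
  have hε0 : (0 : ℝ) < ε := hε.1
  have hlog_pos : 0 < -Real.log ε := neg_pos.2 (Real.log_neg hε0 hε.2)
  have hlog_scale : Real.log (2 ^ (n + 1)) ≤ -Real.log ε + Real.log 2 := by
    rw [pow_succ, Real.log_mul (by positivity) two_ne_zero, ← Real.log_inv]
    gcongr
  rw [Function.comp_apply, Real.log_inv, div_le_iff₀ (sub_pos.2 hsr)] at hlarge
  rw [betaN_eq, partitionSum_zero, div_lt_iff₀ (log_two_pow_pos n.succ_ne_zero)] at hβ
  refine (h.boxRatio_support_le (n := n + 1) hε.2 ?_).trans (EReal.coe_le_coe_iff.2 ?_)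
  · exact ((inv_lt_iff_one_lt_mul₀ hε0).1 hlt).le
  · rw [div_le_iff₀ hlog_pos]
    linarith [mul_le_mul_of_nonneg_left hlog_scale hs]

lemma le_limsup_boxRatio_support : deltaStar ν ≤ limsup (boxRatio ν.support) (𝓝[>] 0) := by
  refine EReal.ge_of_forall_gt_iff_ge.1 fun r hr =>
    le_limsup_of_frequently_le ?_ (by isBoundedDefault)
  obtain ⟨s, hrs, hsδ⟩ := exists_between (EReal.coe_lt_coe_iff.1 hr)
  have hscale : Tendsto (fun n : ℕ => ((1 / 2) ^ n : ℝ≥0)) atTop (𝓝[>] 0) :=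
    tendsto_nhdsWithin_iff.2
      ⟨NNReal.tendsto_pow_atTop_nhds_zero_of_lt_one (NNReal.half_lt_self one_ne_zero),
        .of_forall fun n => mem_Ioi.2 (by positivity)⟩
  refine hscale.frequently (((h.frequently_lt_betaN le_rfl hsδ).and_eventually
    ((tendsto_log_two_pow.eventually_ge_atTop (Real.log 3 / (s - r))).and
      (eventually_ne_atTop 0))).mono ?_)
  rintro n ⟨hβ, hlarge, hn⟩
  have hcoe : (((1 / 2) ^ n : ℝ≥0) : ℝ) = (2 ^ n)⁻¹ := by simp
  have hε1 : (1 / 2 : ℝ≥0) ^ n < 1 := pow_lt_one₀ zero_le (NNReal.half_lt_self one_ne_zero) hn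
  refine (EReal.coe_le_coe_iff.2 ?_).trans (h.le_boxRatio_support (n := n) hε1 ?_)
  · rw [hcoe, Real.log_inv, neg_neg, le_div_iff₀ (log_two_pow_pos hn),
      Real.log_div (h.card_cells_pos n).ne' three_ne_zero]
    rw [betaN_eq, partitionSum_zero, lt_div_iff₀ (log_two_pow_pos hn)] at hβ
    rw [div_le_iff₀ (sub_pos.2 hrs)] at hlarge
    linarith
  · rw [hcoe, mul_inv_cancel₀ (by positivity)]

lemma measureMinkowskiDim_eq : measureMinkowskiDim ν = ENNReal.ofReal (deltaStar ν) := by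
  change (limsup (boxRatio ν.support) (𝓝[>] 0)).toENNReal = _
  rw [le_antisymm h.limsup_boxRatio_support_le h.le_limsup_boxRatio_support,
    EReal.real_coe_toENNReal]

end UnitSupported

/-! ### Hausdorff dimensions of the measure -/

lemma le_dimH_of_measure_le_mul_ediam_rpow {X : Type*} [EMetricSpace X] [MeasurableSpace X]
    [BorelSpace X] {μ : Measure X} {c r : ℝ≥0∞} {d : ℝ≥0} (hc : c ≠ ∞) (hr : 0 < r)
    (hμ : ∀ s, Metric.ediam s ≤ r → μ s ≤ c * Metric.ediam s ^ (d : ℝ)) {E : Set X}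
    (hE : μ E ≠ 0) : d ≤ dimH E := by
  have hle : c⁻¹ • μ ≤ μH[(d : ℝ)] := by
    refine Measure.le_hausdorffMeasure _ _ r hr fun s hs => ?_
    rw [Measure.smul_apply, smul_eq_mul, mul_comm, ← div_eq_mul_inv]
    exact ENNReal.div_le_of_le_mul' (hμ s hs)
  refine le_dimH_of_hausdorffMeasure_ne_zero (ne_bot_of_le_ne_bot ?_ (hle E))
  exact mul_ne_zero (ENNReal.inv_ne_zero.2 hc) hE

lemma coe_inv_two_pow (n : ℕ) : ((2⁻¹ ^ n : ℝ≥0) : ℝ≥0∞) = 2⁻¹ ^ n := by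
  rw [ENNReal.coe_pow, ENNReal.coe_inv two_ne_zero, ENNReal.coe_ofNat]

lemma exists_inv_two_pow_near {D : ℝ≥0∞} {m : ℕ} (hD0 : D ≠ 0) (hD : D ≤ 2⁻¹ ^ m) :
    ∃ n ≥ m, D ≤ 2⁻¹ ^ n ∧ 2⁻¹ ^ (n + 1) < D := by
  have hD1 : D ≤ 1 := hD.trans (pow_le_one₀ zero_le (ENNReal.inv_le_one.2 one_le_two))
  lift D to ℝ≥0 using ne_top_of_le_ne_top ENNReal.one_ne_top hD1
  obtain ⟨n, hlt, hle⟩ := exists_nat_pow_near_of_lt_one (y := (2⁻¹ : ℝ≥0))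
    (pos_iff_ne_zero.2 (ENNReal.coe_ne_zero.1 hD0)) (ENNReal.coe_le_one_iff.1 hD1)
    (by positivity) (inv_lt_one_of_one_lt₀ one_lt_two)
  rw [← ENNReal.coe_lt_coe, coe_inv_two_pow] at hlt
  rw [← ENNReal.coe_le_coe, coe_inv_two_pow] at hle
  refine ⟨n, ?_, hle, hlt⟩
  by_contra! hnm
  exact (hlt.trans_le hD).not_ge
    (pow_le_pow_of_le_one zero_le (ENNReal.inv_le_one.2 one_le_two) hnm)

lemma le_mul_rpow_of_forall_le_inv_two_pow {a C D : ℝ≥0∞} {d : ℝ} (hd : 0 < d) (hC : C ≠ ∞)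
    {m : ℕ} (hD : D ≤ 2⁻¹ ^ m) (ha : ∀ n ≥ m, D ≤ 2⁻¹ ^ n → a ≤ C * (2⁻¹ ^ n) ^ d) :
    a ≤ C * 2 ^ d * D ^ d := by
  rcases eq_or_ne D 0 with rfl | hD0
  · have hlim : Tendsto (fun n : ℕ => C * ((2⁻¹ : ℝ≥0∞) ^ n) ^ d) atTop (𝓝 0) := by
      have hpow := (ENNReal.tendsto_pow_atTop_nhds_zero_of_lt_one
        ENNReal.one_half_lt_one).ennrpow_const d
      rw [ENNReal.zero_rpow_of_pos hd] at hpow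
      simpa using ENNReal.Tendsto.const_mul hpow (Or.inr hC)
    refine (ge_of_tendsto hlim ?_).trans zero_le
    filter_upwards [eventually_ge_atTop m] with n hn using ha n hn zero_le
  · obtain ⟨n, hmn, hDn, hnD⟩ := exists_inv_two_pow_near hD0 hD
    calc a ≤ C * (2⁻¹ ^ n) ^ d := ha n hmn hDn
      _ = C * (2 * 2⁻¹ ^ (n + 1)) ^ d := by
          rw [pow_succ', ← mul_assoc, ENNReal.mul_inv_cancel two_ne_zero ENNReal.ofNat_ne_top,
            one_mul]
      _ ≤ C * (2 * D) ^ d := by gcongr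
      _ = C * 2 ^ d * D ^ d := by rw [ENNReal.mul_rpow_of_nonneg _ _ hd.le, mul_assoc]

lemma le_rpow_mul_rpow_one_sub_of_le {a b t : ℝ} (ha : 0 < a) (hab : a ≤ b) (ht : t ≤ 1) :
    a ≤ a ^ t * b ^ (1 - t) :=
  calc a = a ^ t * a ^ (1 - t) := by rw [← Real.rpow_add ha, add_sub_cancel, Real.rpow_one]
    _ ≤ a ^ t * b ^ (1 - t) := by gcongr

lemma le_rpow_mul_rpow_one_sub_of_ge {a b t : ℝ} (hb : 0 < b) (hba : b ≤ a) (ht : 1 ≤ t) :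
    a ≤ a ^ t * b ^ (1 - t) := by
  have ha : 0 < a := hb.trans_le hba
  calc a = a ^ t * a ^ (1 - t) := by rw [← Real.rpow_add ha, add_sub_cancel, Real.rpow_one]
    _ ≤ a ^ t * b ^ (1 - t) := mul_le_mul_of_nonneg_left
      (Real.rpow_le_rpow_of_nonpos hb hba (sub_nonpos.2 ht)) (by positivity)

/-- The points of `(0,1]` for which the dyadic intervals of all orders `n ≥ m` that contain them
satisfy `p`, the interval `dyadic n k` being described by its indices. -/
def dyadicallyFrom (p : ℕ → ℕ → Prop) (m : ℕ) : Set ℝ :=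
  {x ∈ Ioc (0 : ℝ) 1 | ∀ n ≥ m, ∀ k, x ∈ dyadic n k → p n k}

lemma measurableSet_dyadicallyFrom (p : ℕ → ℕ → Prop) (m : ℕ) :
    MeasurableSet (dyadicallyFrom p m) := by
  have heq : dyadicallyFrom p m =
      Ioc 0 1 ∩ ⋂ n ≥ m, ⋂ (k) (_ : ¬p n k), (dyadic n k)ᶜ := by
    ext x
    simp only [dyadicallyFrom, mem_ofPred_eq, mem_inter_iff, mem_iInter, mem_compl_iff,
      not_imp_not]
  rw [heq]
  exact measurableSet_Ioc.inter (.biInter (to_countable _) fun n _ => .iInter fun k =>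
    .iInter fun _ => (measurableSet_dyadic n k).compl)

lemma exists_subset_biUnion_three_dyadic {n : ℕ} {s : Set ℝ} (hs : s ⊆ Ioc 0 1)
    (hdiam : Metric.ediam s ≤ 2⁻¹ ^ n) :
    ∃ k : ℕ, s ⊆ ⋃ j ∈ Finset.Icc (k - 1) (k + 1), dyadic n j := by
  rcases s.eq_empty_or_nonempty with rfl | ⟨y, hy⟩
  · exact ⟨0, empty_subset _⟩
  obtain ⟨k, -, hyk⟩ := exists_mem_dyadic n (hs hy)
  refine ⟨k, fun x hx => ?_⟩
  obtain ⟨j, -, hxj⟩ := exists_mem_dyadic n (hs hx)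
  have hdist : |2 ^ n * x - 2 ^ n * y| ≤ 1 := by
    have hedist := (Metric.edist_le_ediam_of_mem hx hy).trans hdiam
    rw [edist_dist, ENNReal.ofReal_le_iff_le_toReal (by finiteness), ENNReal.toReal_pow,
      ENNReal.toReal_inv, ENNReal.toReal_ofNat, Real.dist_eq, inv_pow,
      ← mul_le_mul_iff_right₀ (show (0 : ℝ) < 2 ^ n by positivity),
      mul_inv_cancel₀ (by positivity)] at hedist
    rwa [← mul_sub, abs_mul, abs_of_pos (by positivity)]
  obtain ⟨hlo, hhi⟩ := abs_le.1 hdist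
  obtain ⟨hky, hyk⟩ := mem_dyadic_iff.1 hyk
  obtain ⟨hjx, hxj'⟩ := mem_dyadic_iff.1 hxj
  have hjk : j < k + 2 := by
    have : (j : ℝ) < k + 2 := by linarith
    exact_mod_cast this
  have hkj : k < j + 2 := by
    have : (k : ℝ) < j + 2 := by linarith
    exact_mod_cast this
  exact mem_iUnion₂.2 ⟨j, Finset.mem_Icc.2 ⟨by omega, by omega⟩, hxj⟩

section LocalExponent

variable {ν : Measure ℝ} [IsFiniteMeasure ν]

lemma ofReal_two_pow_rpow_neg (n : ℕ) (d : ℝ) :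
    ENNReal.ofReal (((2 : ℝ) ^ n) ^ (-d)) = ((2⁻¹ : ℝ≥0∞) ^ n) ^ d := by
  rw [← ENNReal.ofReal_rpow_of_pos (by positivity), ENNReal.ofReal_pow zero_le_two,
    ENNReal.ofReal_ofNat, ENNReal.rpow_neg, ← ENNReal.inv_rpow, ENNReal.inv_pow]

lemma dimH_dyadicallyFrom_le (d : ℝ≥0) (m : ℕ) :
    dimH (dyadicallyFrom (fun n k => ((2 : ℝ) ^ n) ^ (-(d : ℝ)) ≤ mass ν n k) m) ≤ d := by
  classical
  have hscale : Tendsto (fun n : ℕ => (2⁻¹ ^ n : ℝ≥0)) atTop (𝓝[>] 0) :=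
    tendsto_nhdsWithin_iff.2
      ⟨NNReal.tendsto_pow_atTop_nhds_zero_of_lt_one (inv_lt_one_of_one_lt₀ one_lt_two),
        .of_forall fun n => mem_Ioi.2 (by positivity)⟩
  refine dimH_le_of_frequently_externalCoveringNumber_mul_rpow_le (measure_ne_top ν univ)
    (hscale.frequently ((eventually_ge_atTop m).frequently.mono fun n hn => ?_))
  set F := (Finset.range (2 ^ n)).filter fun k => ((2 : ℝ) ^ n) ^ (-(d : ℝ)) ≤ mass ν n k
  have hsub : dyadicallyFrom (fun n k => ((2 : ℝ) ^ n) ^ (-(d : ℝ)) ≤ mass ν n k) m ⊆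
      closure (⋃ k ∈ F, dyadic n k) := by
    refine subset_trans (fun x hx => ?_) subset_closure
    obtain ⟨k, hk, hxk⟩ := exists_mem_dyadic n hx.1
    exact mem_iUnion₂.2 ⟨k, Finset.mem_filter.2 ⟨Finset.mem_range.2 hk, hx.2 n hn k hxk⟩, hxk⟩
  have hcover := (Metric.externalCoveringNumber_mono_set hsub).trans
    (externalCoveringNumber_biUnion_dyadic_le (ε := 2⁻¹ ^ n) (by simp) F)
  calc _ ≤ (F.card : ℝ≥0∞) * ((2⁻¹ ^ n : ℝ≥0) : ℝ≥0∞) ^ (d : ℝ) := by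
        gcongr
        simpa using ENat.toENNReal_le.2 hcover
    _ ≤ ∑ k ∈ F, ν (dyadic n k) := by
        rw [← nsmul_eq_mul]
        refine Finset.card_nsmul_le_sum _ _ _ fun k hk => ?_
        rw [coe_inv_two_pow, ← ofReal_two_pow_rpow_neg]
        exact ENNReal.ofReal_le_of_le_toReal (Finset.mem_filter.1 hk).2
    _ = ν (⋃ k ∈ F, dyadic n k) := (measure_biUnion_finset
        (fun _ _ _ _ hij => dyadic_disjoint hij) fun k _ => measurableSet_dyadic n k).symm
    _ ≤ ν univ := measure_mono (subset_univ _)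

lemma measure_inter_dyadicallyFrom_le {d : ℝ} {m n : ℕ} (hmn : m ≤ n) {s : Set ℝ}
    (hs : Metric.ediam s ≤ 2⁻¹ ^ n) :
    ν (s ∩ dyadicallyFrom (fun n k => mass ν n k ≤ ((2 : ℝ) ^ n) ^ (-d)) m) ≤
      3 * (2⁻¹ ^ n) ^ d := by
  set S := dyadicallyFrom (fun n k => mass ν n k ≤ ((2 : ℝ) ^ n) ^ (-d)) m
  have hcell : ∀ j, ν (dyadic n j ∩ S) ≤ (2⁻¹ ^ n) ^ d := by
    intro j
    rcases (dyadic n j ∩ S).eq_empty_or_nonempty with hempty | ⟨x, hxj, hxS⟩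
    · rw [hempty, measure_empty]
      exact zero_le
    · calc ν (dyadic n j ∩ S) ≤ ν (dyadic n j) := measure_mono inter_subset_left
        _ ≤ ENNReal.ofReal (((2 : ℝ) ^ n) ^ (-d)) :=
          (ENNReal.le_ofReal_iff_toReal_le (measure_ne_top ν _) (by positivity)).2
            (hxS.2 n hmn j hxj)
        _ = (2⁻¹ ^ n) ^ d := ofReal_two_pow_rpow_neg n d
  obtain ⟨k, hk⟩ := exists_subset_biUnion_three_dyadic (s := s ∩ S) (fun x hx => hx.2.1)
    ((Metric.ediam_mono inter_subset_left).trans hs)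
  calc ν (s ∩ S) ≤ ν (⋃ j ∈ Finset.Icc (k - 1) (k + 1), dyadic n j ∩ S) := by
        rw [← iUnion₂_inter]
        exact measure_mono (subset_inter hk inter_subset_right)
    _ ≤ ∑ j ∈ Finset.Icc (k - 1) (k + 1), ν (dyadic n j ∩ S) := measure_biUnion_finset_le _ _
    _ ≤ (Finset.Icc (k - 1) (k + 1)).card • (2⁻¹ ^ n) ^ d :=
        Finset.sum_le_card_nsmul _ _ _ fun j _ => hcell j
    _ ≤ 3 * (2⁻¹ ^ n) ^ d := by
        rw [nsmul_eq_mul, Nat.card_Icc]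
        gcongr
        exact_mod_cast (by omega : k + 1 + 1 - (k - 1) ≤ 3)

lemma le_dimH_of_measure_inter_dyadicallyFrom_ne_zero {d : ℝ≥0} (hd : 0 < d) {m : ℕ} {E : Set ℝ}
    (hE : ν (E ∩ dyadicallyFrom (fun n k => mass ν n k ≤ ((2 : ℝ) ^ n) ^ (-(d : ℝ))) m) ≠ 0) :
    d ≤ dimH E := by
  have hS := measurableSet_dyadicallyFrom
    (fun n k => mass ν n k ≤ ((2 : ℝ) ^ n) ^ (-(d : ℝ))) m
  rw [← Measure.restrict_apply' hS] at hE
  refine le_dimH_of_measure_le_mul_ediam_rpow (c := 3 * 2 ^ (d : ℝ)) (r := 2⁻¹ ^ m)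
    (by finiteness) (ENNReal.pow_pos (by simp) m) (fun s hs => ?_) hE
  rw [Measure.restrict_apply' hS]
  exact le_mul_rpow_of_forall_le_inv_two_pow hd ENNReal.ofNat_ne_top hs
    fun n hn hsn => measure_inter_dyadicallyFrom_le hn hsn

namespace UnitSupported

variable (h : UnitSupported ν) {p : ℕ → ℕ → Prop} {d t : ℝ}
include h

lemma measureReal_biUnion_dyadic_le {n : ℕ} (hn : n ≠ 0) {q : ℕ → Prop} [DecidablePred q]
    {b : ℝ} (hq : ∀ k ∈ cells ν n, q k → mass ν n k ≤ mass ν n k ^ t * ((2 : ℝ) ^ n) ^ b) :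
    ν.real (⋃ k ∈ (cells ν n).filter q, dyadic n k) ≤ ((2 : ℝ) ^ n) ^ (betaN ν n t + b) :=
  calc ν.real (⋃ k ∈ (cells ν n).filter q, dyadic n k)
      ≤ ∑ k ∈ (cells ν n).filter q, mass ν n k := measureReal_biUnion_finset_le _ _
    _ ≤ ∑ k ∈ (cells ν n).filter q, mass ν n k ^ t * ((2 : ℝ) ^ n) ^ b :=
        Finset.sum_le_sum fun k hk => (Finset.mem_filter.1 hk).elim (hq k)
    _ ≤ ∑ k ∈ cells ν n, mass ν n k ^ t * ((2 : ℝ) ^ n) ^ b :=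
        Finset.sum_le_sum_of_subset_of_nonneg (Finset.filter_subset _ _) fun k hk _ => by
          have := mass_pos hk
          positivity
    _ = ((2 : ℝ) ^ n) ^ (betaN ν n t + b) := by
        rw [← Finset.sum_mul, Real.rpow_add (by positivity), ← h.partitionSum_eq_rpow hn,
          partitionSum]

lemma ae_exists_mem_dyadicallyFrom (ht : 0 ≤ t) (hd : betaReal ν t < d * (1 - t))
    (hp : ∀ n, ∀ k ∈ cells ν n, ¬p n k →
      mass ν n k ≤ mass ν n k ^ t * (((2 : ℝ) ^ n) ^ (-d)) ^ (1 - t)) :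
    ∀ᵐ x ∂ν, ∃ m, x ∈ dyadicallyFrom p m := by
  classical
  obtain ⟨s, hβs, hs⟩ := exists_between hd
  have hsum : Summable fun n =>
      ν.real (⋃ k ∈ (cells ν n).filter fun k => ¬p n k, dyadic n k) := by
    have hgeo : Summable fun n : ℕ => ((2 : ℝ) ^ (s - d * (1 - t))) ^ n :=
      summable_geometric_of_lt_one (by positivity)
        (Real.rpow_lt_one_of_one_lt_of_neg one_lt_two (sub_neg.2 hs))
    refine hgeo.of_norm_bounded_eventually_nat ?_
    filter_upwards [h.eventually_betaN_lt ht hβs, eventually_ne_atTop 0] with n hn hn0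
    rw [Real.norm_of_nonneg measureReal_nonneg, Real.rpow_pow_comm zero_le_two]
    have hmass : ∀ k ∈ cells ν n, ¬p n k →
        mass ν n k ≤ mass ν n k ^ t * ((2 : ℝ) ^ n) ^ (-d * (1 - t)) := by
      intro k hk hpk
      rw [Real.rpow_mul (by positivity)]
      exact hp n k hk hpk
    have hexp : betaN ν n t + -d * (1 - t) ≤ s - d * (1 - t) := by linarith
    exact (h.measureReal_biUnion_dyadic_le hn0 hmass).trans
      (Real.rpow_le_rpow_of_exponent_le (one_le_pow₀ one_le_two) hexp)
  have hbad : ∀ᵐ x ∂ν, ∀ᶠ n in atTop, x ∉ ⋃ k ∈ (cells ν n).filter fun k => ¬p n k, dyadic n k :=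
    ae_eventually_notMem (by simpa [Measure.real] using hsum.tsum_ofReal_ne_top)
  filter_upwards [h.ae_mem, ae_all_iff.2 h.ae_exists_mem_cells, hbad] with x hx hcell hgood
  obtain ⟨m, hm⟩ := eventually_atTop.1 hgood
  refine ⟨m, hx, fun n hn k hxk => not_not.1 fun hpk => hm n hn ?_⟩
  obtain ⟨j, hj, hxj⟩ := hcell n
  obtain rfl : j = k := not_not.1 fun hne => disjoint_left.1 (dyadic_disjoint hne) hxj hxk
  exact mem_iUnion₂.2 ⟨j, Finset.mem_filter.2 ⟨hj, hpk⟩, hxk⟩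

lemma measureHausdorffDim_le (ht : t ∈ Ico (0 : ℝ) 1) :
    measureHausdorffDim ν ≤ ENNReal.ofReal (betaReal ν t / (1 - t)) := by
  refine le_of_forall_gt_imp_ge_of_dense fun a ha => ?_
  obtain ⟨d, hd, hda⟩ := ENNReal.lt_iff_exists_nnreal_btwn.1 ha
  refine le_trans ?_ hda.le
  have hslope : 0 ≤ betaReal ν t / (1 - t) :=
    div_nonneg (h.betaReal_nonneg ⟨ht.1, ht.2.le⟩) (sub_nonneg.2 ht.2.le)
  rw [← ENNReal.ofReal_coe_nnreal, ENNReal.ofReal_lt_ofReal_iff_of_nonneg hslope] at hd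
  set S := dyadicallyFrom fun n k => ((2 : ℝ) ^ n) ^ (-(d : ℝ)) ≤ mass ν n k
  have hfull : ∀ᵐ x ∂ν, x ∈ ⋃ m, S m := by
    simp only [mem_iUnion]
    exact h.ae_exists_mem_dyadicallyFrom ht.1 ((div_lt_iff₀ (sub_pos.2 ht.2)).1 hd)
      fun n k hk hlt => le_rpow_mul_rpow_one_sub_of_le (mass_pos hk) (not_le.1 hlt).le ht.2.le
  calc measureHausdorffDim ν ≤ dimH (⋃ m, S m) :=
        iInf₂_le_of_le _ (.iUnion fun m => measurableSet_dyadicallyFrom _ m) (iInf_le _ hfull)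
    _ = ⨆ m, dimH (S m) := dimH_iUnion S
    _ ≤ d := iSup_le fun m => dimH_dyadicallyFrom_le d m

lemma le_measureLowerHausdorffDim (ht : 1 < t) :
    ENNReal.ofReal (betaReal ν t / (1 - t)) ≤ measureLowerHausdorffDim ν := by
  refine le_iInf₂ fun E _ => le_iInf fun hE => ENNReal.le_of_forall_nnreal_lt fun d hd => ?_
  rcases eq_zero_or_pos d with rfl | hd0
  · exact zero_le
  rw [← ENNReal.ofReal_coe_nnreal, ENNReal.ofReal_lt_ofReal_iff_of_nonneg d.coe_nonneg,
    lt_div_iff_of_neg (sub_neg.2 ht)] at hd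
  have hfull := h.ae_exists_mem_dyadicallyFrom (zero_le_one.trans ht.le) hd
    (p := fun n k => mass ν n k ≤ ((2 : ℝ) ^ n) ^ (-(d : ℝ))) fun n k _ hlt =>
      le_rpow_mul_rpow_one_sub_of_ge (by positivity) (not_le.1 hlt).le ht.le
  by_contra hdim
  refine hE.ne' (measure_eq_zero_iff_ae_notMem.2 ?_)
  have hnull := fun m => measure_eq_zero_iff_ae_notMem.1 (not_not.1
    (mt (le_dimH_of_measure_inter_dyadicallyFrom_ne_zero (ν := ν) (m := m) hd0) hdim))
  filter_upwards [hfull, ae_all_iff.2 hnull] with x ⟨m, hxm⟩ hx hxE using hx m ⟨hxE, hxm⟩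

end UnitSupported

end LocalExponent

/-! ### The slopes of the spectrum at `1` -/

/-- The `L^q`-spectrum is affine on `[0,1]`: it coincides there with its chord, which joins
`(0, δ*)` to `(1, 0)`. -/
def SpectrumAffine (ν : Measure ℝ) : Prop :=
  ∀ t ∈ Ico (0 : ℝ) 1, betaReal ν t = deltaStar ν * (1 - t)

namespace UnitSupported

variable {ν : Measure ℝ} [IsFiniteMeasure ν] {δ s : ℝ} (h : UnitSupported ν)

include h

lemma deltaStar_nonneg : 0 ≤ deltaStar ν :=
  h.betaReal_nonneg ⟨le_rfl, zero_le_one⟩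

lemma antitoneOn_betaReal_div :
    AntitoneOn (fun t => betaReal ν t / (1 - t)) (Ici 0 \ {1}) := by
  intro t ht u hu htu
  have hslope := h.convexOn_betaReal.slope_mono (x := 1) (mem_Ici.2 zero_le_one) ht hu htu
  simp only [slope_def_field, h.betaReal_one, sub_zero] at hslope
  simpa only [← neg_sub _ (1 : ℝ), div_neg] using neg_le_neg hslope

lemma betaReal_div_le_deltaStar {t : ℝ} (ht : t ∈ Ico (0 : ℝ) 1) :
    betaReal ν t / (1 - t) ≤ deltaStar ν := by
  simpa only [sub_zero, div_one, deltaStar, betaReal] using h.antitoneOn_betaReal_div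
    (a := 0) ⟨self_mem_Ici, zero_ne_one⟩ ⟨ht.1, ht.2.ne⟩ ht.1

lemma spectrumAffine_of_le (hle : ∀ t ∈ Ico (0 : ℝ) 1, deltaStar ν ≤ betaReal ν t / (1 - t)) :
    SpectrumAffine ν := fun t ht =>
  (div_eq_iff (sub_pos.2 ht.2).ne').1 ((h.betaReal_div_le_deltaStar ht).antisymm (hle t ht))

lemma deltaUpperEq_iff : DeltaUpperEq ν (deltaStar ν) ↔ SpectrumAffine ν := by
  constructor
  · intro hlim
    refine h.spectrumAffine_of_le fun t ht => le_of_tendsto hlim ?_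
    filter_upwards [Ioo_mem_nhdsLT ht.2] with u hu
    exact h.antitoneOn_betaReal_div ⟨ht.1, ht.2.ne⟩ ⟨ht.1.trans hu.1.le, hu.2.ne⟩ hu.1.le
  · intro haff
    refine tendsto_const_nhds.congr' ?_
    filter_upwards [Ioo_mem_nhdsLT zero_lt_one] with t ht
    exact (eq_div_iff (sub_pos.2 ht.2).ne').2 (haff t ⟨ht.1.le, ht.2⟩).symm

lemma spectrumAffine_of_deltaLowerEq (hlim : DeltaLowerEq ν (deltaStar ν)) :
    SpectrumAffine ν := by
  refine h.spectrumAffine_of_le fun t ht => le_of_tendsto hlim ?_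
  filter_upwards [self_mem_nhdsWithin] with u (hu : 1 < u)
  exact h.antitoneOn_betaReal_div ⟨ht.1, ht.2.ne⟩ ⟨zero_le_one.trans hu.le, hu.ne'⟩
    (ht.2.trans hu).le

lemma spectrumAffine_of_eq {q : ℝ} (hq : q ∈ Ioo (0 : ℝ) 1)
    (heq : betaReal ν q = deltaStar ν * (1 - q)) : SpectrumAffine ν := by
  refine h.spectrumAffine_of_le fun t ht => ?_
  rcases le_total t q with htq | hqt
  · exact ((eq_div_iff (sub_pos.2 hq.2).ne').2 heq.symm).trans_le
      (h.antitoneOn_betaReal_div ⟨ht.1, ht.2.ne⟩ ⟨hq.1.le, hq.2.ne⟩ htq)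
  · have ht0 : 0 < t := hq.1.trans_le hqt
    have hslope := h.convexOn_betaReal.slope_mono (x := 0) self_mem_Ici
      (a := q) ⟨hq.1.le, hq.1.ne'⟩ ⟨ht0.le, ht0.ne'⟩ hqt
    have hslope_q : slope (betaReal ν) 0 q = -deltaStar ν := by
      rw [slope_def_field, heq, div_eq_iff (by simpa using hq.1.ne')]
      change _ - deltaStar ν = _
      ring
    rw [hslope_q, slope_def_field, sub_zero, le_div_iff₀ ht0] at hslope
    change _ ≤ _ - deltaStar ν at hslope
    rw [le_div_iff₀ (sub_pos.2 ht.2)]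
    linarith

lemma spectrumAffine_of_dim_eq (hdim : measureMinkowskiDim ν = measureHausdorffDim ν) :
    SpectrumAffine ν := by
  refine h.spectrumAffine_of_le fun t ht => ?_
  have hle := h.measureHausdorffDim_le ht
  rwa [← hdim, h.measureMinkowskiDim_eq, ENNReal.ofReal_le_ofReal_iff
    (div_nonneg (h.betaReal_nonneg ⟨ht.1, ht.2.le⟩) (sub_pos.2 ht.2).le)] at hle

lemma qBar_eq_of_spectrumAffine (haff : SpectrumAffine ν) :
    qBar ν = deltaStar ν / (1 + deltaStar ν) := by
  have hδ := h.deltaStar_nonneg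
  rw [eq_div_iff (by positivity)]
  rcases h.qBar_nonneg.eq_or_lt with h0 | hpos
  · have hhalf := h.betaReal_le_qBar (q := 1 / 2) (by rw [← h0]; norm_num)
    rw [← h0, haff (1 / 2) ⟨by norm_num, by norm_num⟩] at hhalf
    rw [← h0]
    linarith
  · have hfix := h.betaReal_qBar hpos
    have hlt : qBar ν < 1 := h.qBar_le_one.lt_of_ne fun h1 => by
      rw [h1, h.betaReal_one] at hfix
      exact zero_ne_one hfix
    rw [haff _ ⟨hpos.le, hlt⟩] at hfix
    linarith

lemma spectrumAffine_of_qBar_eq (hq : qBar ν = deltaStar ν / (1 + deltaStar ν)) :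
    SpectrumAffine ν := by
  rcases h.deltaStar_nonneg.eq_or_lt with h0 | hpos
  · refine h.spectrumAffine_of_le fun t ht => ?_
    rw [← h0]
    exact div_nonneg (h.betaReal_nonneg ⟨ht.1, ht.2.le⟩) (sub_pos.2 ht.2).le
  · have hq0 : 0 < qBar ν := by rw [hq]; positivity
    have hq1 : qBar ν < 1 := by rw [hq, div_lt_one (by positivity)]; linarith
    refine h.spectrumAffine_of_eq ⟨hq0, hq1⟩ ?_
    rw [h.betaReal_qBar hq0, hq]
    field_simp
    ring

lemma hasSpectralDim_iff (hreg : IsLqRegular ν) : HasSpectralDim ν s ↔ qBar ν = s :=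
  ⟨tendsto_nhds_unique (h.hasSpectralDim_qBar hreg), fun hs => hs ▸ h.hasSpectralDim_qBar hreg⟩

lemma spectrumAffine_iff_hasSpectralDim (hreg : IsLqRegular ν) :
    SpectrumAffine ν ↔ HasSpectralDim ν (deltaStar ν / (1 + deltaStar ν)) := by
  rw [h.hasSpectralDim_iff hreg]
  exact ⟨h.qBar_eq_of_spectrumAffine, h.spectrumAffine_of_qBar_eq⟩

lemma deltaLowerEq_of_differentiableAt (hdiff : DifferentiableAt ℝ (betaReal ν) 1)
    (hupper : DeltaUpperEq ν δ) : DeltaLowerEq ν δ := by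
  have hratio : Tendsto (fun t => betaReal ν t / (1 - t)) (𝓝[≠] 1)
      (𝓝 (-deriv (betaReal ν) 1)) := by
    refine (hasDerivAt_iff_tendsto_slope.1 hdiff.hasDerivAt).neg.congr fun t => ?_
    rw [slope_def_field, h.betaReal_one, sub_zero, ← div_neg, neg_sub]
  have hδ := tendsto_nhds_unique hupper (hratio.mono_left (nhdsLT_le_nhdsNE 1))
  rw [hδ]
  exact hratio.mono_left (nhdsGT_le_nhdsNE 1)

lemma ofReal_le_measureLowerHausdorffDim (hlower : DeltaLowerEq ν δ) :
    ENNReal.ofReal δ ≤ measureLowerHausdorffDim ν := by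
  refine le_of_tendsto ((ENNReal.continuous_ofReal.tendsto δ).comp hlower) ?_
  filter_upwards [self_mem_nhdsWithin] with t ht using h.le_measureLowerHausdorffDim ht

end UnitSupported

end KreinFeller

end

theorem corollary1p7 (ν : Measure ℝ) [IsFiniteMeasure ν] (hν_ne : ν ≠ 0)
    (hν_supp : ν (Ioo (0 : ℝ) 1)ᶜ = 0) (hreg : KreinFeller.IsLqRegular ν) :
    (∃ s : ℝ, KreinFeller.HasSpectralDim ν s) ∧
    (KreinFeller.DeltaUpperEq ν (KreinFeller.deltaStar ν) ↔
      KreinFeller.HasSpectralDim ν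
        (KreinFeller.deltaStar ν / (1 + KreinFeller.deltaStar ν))) ∧
    (KreinFeller.DeltaLowerEq ν (KreinFeller.deltaStar ν) →
      KreinFeller.HasSpectralDim ν
        (KreinFeller.deltaStar ν / (1 + KreinFeller.deltaStar ν))) ∧
    (KreinFeller.measureMinkowskiDim ν = KreinFeller.measureHausdorffDim ν →
      KreinFeller.HasSpectralDim ν
        (KreinFeller.deltaStar ν / (1 + KreinFeller.deltaStar ν))) ∧
    (KreinFeller.BetaDifferentiableAt ν 1 →
      KreinFeller.HasSpectralDim ν
        (KreinFeller.deltaStar ν / (1 + KreinFeller.deltaStar ν)) →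
      KreinFeller.measureMinkowskiDim ν = KreinFeller.measureHausdorffDim ν ∧
      KreinFeller.measureHausdorffDim ν = KreinFeller.measureLowerHausdorffDim ν ∧
      KreinFeller.measureLowerHausdorffDim ν = KreinFeller.measurePackingDim ν) := by
  have h : KreinFeller.UnitSupported ν := ⟨hν_ne, hν_supp⟩
  have haff := h.spectrumAffine_iff_hasSpectralDim hreg
  refine ⟨⟨_, h.hasSpectralDim_qBar hreg⟩, h.deltaUpperEq_iff.trans haff,
    fun hlower => haff.1 (h.spectrumAffine_of_deltaLowerEq hlower),
    fun hdim => haff.1 (h.spectrumAffine_of_dim_eq hdim), fun hdiff hs => ?_⟩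
  have hlower := h.deltaLowerEq_of_differentiableAt hdiff.2 (h.deltaUpperEq_iff.2 (haff.2 hs))
  have minkowski_le_lower :=
    h.measureMinkowskiDim_eq.trans_le (h.ofReal_le_measureLowerHausdorffDim hlower)
  have lower_le_hausdorff := KreinFeller.measureLowerHausdorffDim_le_measureHausdorffDim hν_ne
  have hausdorff_le_packing := KreinFeller.measureHausdorffDim_le_measurePackingDim ν
  have packing_le_minkowski := KreinFeller.measurePackingDim_le_measureMinkowskiDim ν
  have hausdorff_le_minkowski := hausdorff_le_packing.trans packing_le_minkowski
  exact ⟨(minkowski_le_lower.trans lower_le_hausdorff).antisymm hausdorff_le_minkowski,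
    (hausdorff_le_minkowski.trans minkowski_le_lower).antisymm lower_le_hausdorff,
    (lower_le_hausdorff.trans hausdorff_le_packing).antisymm
      (packing_le_minkowski.trans minkowski_le_lower)⟩
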